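/- Let $X\in\mathbb R^d$ ($d\ge 1$) be a random vector with law $\mathrm P$, $\mathbb E\|X\|^4<\infty$, and let $X_1,\dots,X_n$ be i.i.d. with law $\mathrm P$. Put $G=\mathbb E(XX^\top)$, $s_4^2=\mathbb E(\|X\|^4)^{1/2}$, $$\kappa=\sup_{\theta:\ \mathbb E\langle\theta,X\rangle^2>0}\frac{\mathbb E\langle\theta,X\rangle^4}{(\mathbb E\langle\theta,X\rangle^2)^2},\qquad c=\frac{15}{8\log 2\,(\sqrt2-1)}\exp\Bigl(\frac{1+2\sqrt2}{2}\Bigr).$$ Let $a>0$, $\varepsilon>0$, $0<\sigma\le s_4^2$, $K=1+\bigl\lceil a^{-1}\log\bigl(\tfrac{n}{72(2+c)\kappa^{1/2}}\bigr)\bigr\rceil$, $$\zeta(t)=\sqrt{2(\kappa-1)\Bigl(\frac{(2+3c)s_4^2}{4(2+c)\kappa^{1/2}t}+\log(K/\varepsilon)\Bigr)}\cosh(a/4)+\sqrt{\frac{2(2+c)\kappa^{1/2}s_4^2}{t}}\cosh(a/2),$$ and $$B_*(t)=\frac{n^{-1/2}\zeta(\max\{t,\sigma\})}{1-4n^{-1/2}\zeta(\max\{t,\sigma\})}\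 \text{ if }\ [6+(\kappa-1)^{-1}]\zeta(\max\{t,\sigma\})\le\sqrt n,\qquad B_*(t)=+\infty\ \text{ otherwise.}$$ *Estimator.* Let $\psi:\mathbb R\to\mathbb R$ be the odd function with $\psi(t)=-\log(1-t+t^2/2)$ on $[0,1]$ and $\psi(t)=\log 2$ for $t\ge1$, and for $\lambda>0$ let $r_\lambda(\theta)=\frac1n\sum_{k=1}^n\psi(\langle\theta,X_k\rangle^2-\lambda)$. For $j=1,\dots,K$ put $$\lambda^{(j)}=\sqrt{\frac{2}{n(\kappa-1)}\Bigl(\frac{2+3c}{4(2+c)\kappa^{1/2}e^{-(j-1/2)a}}+\log(K/\varepsilon)\Bigr)},\qquad \beta^{(j)}=\sqrt{2(2+c)\kappa^{1/2}s_4^4\,n\,e^{-(j-1)a}}.$$ For a unit vector $\theta$, the confidence region $I(\theta)$ for $\theta^\top G\theta$ is the set of all $v\ge0$ such that for all $1\le j\le K$ and all $\alpha>0$, with $\lambda=\lambda^{(j)}$ and $\beta=\beta^{(j)}$, $$\bigl|r_\lambda(\alpha\theta)-(\alpha^2v-\lambda)\bigr|\le\frac{\kappa\alpha^4v^2-2\lambda\alpha^2v+\lambda^2}{2}+\frac{(2+c)\kappa^{1/2}s_4^2\alpha^2v}{\beta}+\frac{(2+3c)s_4^4}{2\beta^2}+\frac{\beta\alpha^2}{2n}+\frac{\log(K/\varepsilon)}{n}.$$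 Let $\Theta$ be a finite $\delta$-net of the unit sphere of $\mathbb R^d$ (a finite set of unit vectors such that every unit vector is within distance $\delta$ of one of them). Let $Q$ be a symmetric matrix of minimal Frobenius norm among the symmetric matrices $H$ with $\theta^\top H\theta\in I(\theta)$ for all $\theta\in\Theta$, and let $\widehat G=Q_+$ be its positive part (same eigenvectors, each eigenvalue $\mu$ replaced by $\max\{\mu,0\}$). Denote by $\lambda_1\ge\dots\ge\lambda_d$ and $\widehat\lambda_1\ge\dots\ge\widehat\lambda_d$ the eigenvalues of $G$ and of $\widehat G$, with multiplicity, and $\|M\|_F^2=\mathrm{Tr}(M^\top M)$. **Statement.** Assume $8\zeta(\sigma)\le\sqrt n$ and $\kappa\ge 3/2$. Then there is an event of probability at least $1-2\varepsilon$ on which such a $Q$ exists and, for every such $Q$ and every $i=1,\dots,d$, $$|\lambda_i-\widehat\lambda_i|\le 2\max\{\lambda_1,\sigma\}\,B_*(\lambda_1)+5\delta\|G\|_F+\sigma,$$ $$|\lambda_i-\widehat\lambda_i|\le 2\max\{\widehat\lambda_1,\sigma\}\,B_*\bigl(\min\{\widehat\lambda_1,s_4^2\}\bigr)+5\delta\|G\|_F+\sigma.$$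 -/

import Mathlib

open MeasureTheory ProbabilityTheory

noncomputable section

namespace RobustGram

/-- `ℝ^d` with its Euclidean norm and inner product. -/
abbrev Vec (d : ℕ) : Type := EuclideanSpace ℝ (Fin d)

variable {d n : ℕ}

/-! ### Matrices -/

/-- The quadratic form `θᵀ M θ`. -/
def quad (M : Matrix (Fin d) (Fin d) ℝ) (θ : Vec d) : ℝ := ∑ i, ∑ j, θ i * M i j * θ j

/-- The Frobenius norm, `‖M‖_F² = Tr (Mᵀ M)`. -/
def frob (M : Matrix (Fin d) (Fin d) ℝ) : ℝ := Real.sqrt (Matrix.trace (M.transpose * M))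

/-- The `i`-th largest eigenvalue of a symmetric matrix, counted with multiplicity
(`i = 0` is the largest one). -/
def eig (M : Matrix (Fin d) (Fin d) ℝ) (hM : M.IsHermitian) (i : Fin d) : ℝ :=
  hM.eigenvalues₀ (i.cast (Fintype.card_fin d).symm)

/-- The positive part `Q₊` of a symmetric matrix `Q = Q₊ - Q₋`: same eigenvectors, every eigenvalue
`μ` replaced by `max μ 0`. -/
def positivePart (Q : Matrix (Fin d) (Fin d) ℝ) : Matrix (Fin d) (Fin d) ℝ :=
  cfc (fun x : ℝ => max x 0) Q

lemma positivePart_isHermitian (Q : Matrix (Fin d) (Fin d) ℝ) : (positivePart Q).IsHermitian :=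
  cfc_predicate (p := IsSelfAdjoint) (fun x : ℝ => max x 0) Q

/-! ### Quantities attached to the law `P` -/

/-- The Gram matrix `G = E (X Xᵀ)`. -/
def gram (P : Measure (Vec d)) : Matrix (Fin d) (Fin d) ℝ :=
  Matrix.of fun i j => ∫ x, x i * x j ∂P

lemma gram_isHermitian (P : Measure (Vec d)) : (gram P).IsHermitian := by
  ext i j
  simp [gram, Matrix.conjTranspose_apply, mul_comm]

/-- `κ = sup E⟨θ,X⟩⁴ / (E⟨θ,X⟩²)²` over all `θ` with `E⟨θ,X⟩² > 0`. For a law with a finite fourth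
moment on `ℝ^d` this set of ratios is bounded. -/
def kurtosis (P : Measure (Vec d)) : ℝ :=
  sSup {y : ℝ | ∃ θ : Vec d, 0 < ∫ x, (inner ℝ θ x) ^ 2 ∂P ∧
    y = (∫ x, (inner ℝ θ x) ^ 4 ∂P) / (∫ x, (inner ℝ θ x) ^ 2 ∂P) ^ 2}

/-- `s₄² = (E ‖X‖⁴)^{1/2}`. -/
def s4sq (P : Measure (Vec d)) : ℝ := Real.sqrt (∫ x, ‖x‖ ^ 4 ∂P)

/-! ### The bound `B_*`

Below `κ` and `s` stand for the values of `kurtosis P` and `s4sq P`. -/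

/-- `c = 15 / (8 log 2 (√2 - 1)) · exp ((1 + 2√2) / 2)`. -/
def cst : ℝ :=
  15 / (8 * Real.log 2 * (Real.sqrt 2 - 1)) * Real.exp ((1 + 2 * Real.sqrt 2) / 2)

/-- `K = 1 + ⌈a⁻¹ log (n / (72 (2 + c) κ^{1/2}))⌉`. -/
def gridSize (n : ℕ) (κ a : ℝ) : ℤ :=
  1 + ⌈a⁻¹ * Real.log ((n : ℝ) / (72 * (2 + cst) * Real.sqrt κ))⌉

/-- The function `ζ`. -/
def zeta (n : ℕ) (κ s a ε t : ℝ) : ℝ :=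
  Real.sqrt (2 * (κ - 1) *
      ((2 + 3 * cst) * s / (4 * (2 + cst) * Real.sqrt κ * t)
        + Real.log ((gridSize n κ a : ℝ) / ε))) * Real.cosh (a / 4)
    + Real.sqrt (2 * (2 + cst) * Real.sqrt κ * s / t) * Real.cosh (a / 2)

open Classical in
/-- The function `B_*`, with values in `(-∞, +∞]`. -/
def Bstar (n : ℕ) (κ s a ε σ t : ℝ) : EReal :=
  if (6 + (κ - 1)⁻¹) * zeta n κ s a ε (max t σ) ≤ Real.sqrt n then
    (((zeta n κ s a ε (max t σ) / Real.sqrt n)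
      / (1 - 4 * (zeta n κ s a ε (max t σ) / Real.sqrt n)) : ℝ) : EReal)
  else ⊤

/-! ### The robust estimator -/

/-- The truncation function: odd, `ψ t = -log (1 - t + t²/2)` on `[0, 1]`, `ψ t = log 2` for
`t ≥ 1`. -/
def psi (t : ℝ) : ℝ :=
  if 0 ≤ t then -Real.log (1 - min t 1 + (min t 1) ^ 2 / 2)
  else Real.log (1 - min (-t) 1 + (min (-t) 1) ^ 2 / 2)

/-- The truncated empirical criterion `r_λ(θ) = n⁻¹ ∑ᵢ ψ(⟨θ, xᵢ⟩² - λ)`. -/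
def crit (lam : ℝ) (x : Fin n → Vec d) (θ : Vec d) : ℝ :=
  (n : ℝ)⁻¹ * ∑ i, psi ((inner ℝ θ (x i)) ^ 2 - lam)

/-- The grid of scales `λ_j`, `1 ≤ j ≤ K`. -/
def lamGrid (n : ℕ) (κ a ε : ℝ) (j : ℤ) : ℝ :=
  Real.sqrt (2 / ((n : ℝ) * (κ - 1)) *
    ((2 + 3 * cst) / (4 * (2 + cst) * Real.sqrt κ * Real.exp (-((j : ℝ) - 1 / 2) * a))
      + Real.log ((gridSize n κ a : ℝ) / ε)))

/-- The grid of inverse variances `β_j`, `1 ≤ j ≤ K`, of the Gaussian perturbations. -/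
def betaGrid (n : ℕ) (κ s a : ℝ) (j : ℤ) : ℝ :=
  Real.sqrt (2 * (2 + cst) * Real.sqrt κ * s ^ 2 * (n : ℝ) * Real.exp (-((j : ℝ) - 1) * a))

/-- The PAC-Bayesian bound on the deviation of `r_λ(αθ)` from `α² v - λ`, for a unit vector `θ` with
`E⟨θ, X⟩² = v`, when the parameter is perturbed by a Gaussian of covariance `β⁻¹ I`. -/
def dev (n : ℕ) (κ s a ε lam beta α v : ℝ) : ℝ :=
  (κ * (α ^ 2 * v) ^ 2 - 2 * lam * (α ^ 2 * v) + lam ^ 2) / 2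
    + (2 + cst) * Real.sqrt κ * s * (α ^ 2 * v) / beta
    + (2 + 3 * cst) * s ^ 2 / (2 * beta ^ 2)
    + beta * α ^ 2 / (2 * (n : ℝ))
    + Real.log ((gridSize n κ a : ℝ) / ε) / (n : ℝ)

/-- The confidence region for `θᵀ G θ`, `‖θ‖ = 1`: all values `v ≥ 0` that the PAC-Bayesian
inequalities do not exclude. -/
def confRegion (κ s a ε : ℝ) (x : Fin n → Vec d) (θ : Vec d) : Set ℝ :=
  {v | 0 ≤ v ∧ ∀ j : ℤ, 1 ≤ j → j ≤ gridSize n κ a → ∀ α : ℝ, 0 < α →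
    |crit (lamGrid n κ a ε j) x (α • θ) - (α ^ 2 * v - lamGrid n κ a ε j)|
      ≤ dev n κ s a ε (lamGrid n κ a ε j) (betaGrid n κ s a j) α v}

/-- `Θ` is a finite `δ`-net of the unit sphere. -/
def IsSphereNet (δ : ℝ) (Θ : Finset (Vec d)) : Prop :=
  (∀ θ ∈ Θ, ‖θ‖ = 1) ∧ ∀ θ : Vec d, ‖θ‖ = 1 → ∃ θ' ∈ Θ, ‖θ - θ'‖ ≤ δ

/-- Symmetric matrices whose quadratic form meets the confidence constraints on the net. -/
def admissible (κ s a ε : ℝ) (Θ : Finset (Vec d)) (x : Fin n → Vec d) :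
    Set (Matrix (Fin d) (Fin d) ℝ) :=
  {Q | Q.IsSymm ∧ ∀ θ ∈ Θ, quad Q θ ∈ confRegion κ s a ε x θ}

/-- `Q` is the solution of the convex program: minimal Frobenius norm among the admissible
matrices. The robust estimator of the Gram matrix is then `positivePart Q`. -/
def IsSolution (κ s a ε : ℝ) (Θ : Finset (Vec d)) (x : Fin n → Vec d)
    (Q : Matrix (Fin d) (Fin d) ℝ) : Prop :=
  Q ∈ admissible κ s a ε Θ x ∧ ∀ Q' ∈ admissible κ s a ε Θ x, frob Q ≤ frob Q'

end RobustGram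

end

noncomputable section

namespace RobustGram

variable {d n : ℕ}

/-! ### Scalar analysis of the confidence regions -/

/-! The proof has a probabilistic half and a deterministic half.

On one event of probability at least 1 - 2ε, θᵀGθ lies in I(θ) for all unit θ at once
(`exists_coverage_event`). This is a PAC-Bayesian bound in which αθ is perturbed by a Gaussian of
covariance β⁻¹I. The truncation ψ is not convex, so Jensen does not apply to it; instead a bounded
function χ ≥ ψ lies, for every m, above some parabola of curvature -1/4 taking the value ψ(m) at m
(`exists_chi_tangent`). Hence ψ at a mean is at most the mean of χ plus one eighth of the variance
(`psi_integral_le`), while exp χ is below a quadratic polynomial, so that fourth moments control the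
exponential moments (`exp_chi_add_le`). Markov's inequality and the Donsker–Varadhan inequality make
the bound uniform in θ (`pac_bayes`), at the entropy price β‖θ‖²/2.

The rest is deterministic. The map α ↦ r_λ(αθ) is nondecreasing on α ≥ 0. If v ≤ t < v' with v, v'
in I(θ), the constraint for v makes r_λ negative at α₁² = (1-z)λ/t, and the one for v' makes it
nonnegative at α₂² = (1+B)λ/v', where B = z/(1-4z). So α₁ ≤ α₂, that is v' - t ≤ 2tB
(`sub_le_of_mem_region`). For the grid scale adapted to t, z can be taken to be ζ(t)/√n
(`grid_precision`). Since tB(t) is nondecreasing (`mul_relErr_mono`), t may be replaced by a larger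
level, built from λ₁ or from the top eigenvalue of the estimator.

On the event G is itself admissible, so Q exists and ‖Q‖_F ≤ ‖G‖_F. Going from the net to the sphere
costs 2δ‖G‖_F for each of G and Q, Courant–Fischer passes the comparison of max(·, σ) to eigenvalues
(`eig_compare`), and removing the truncation at σ costs σ. -/

lemma cst_pos : 0 < cst := by
  unfold cst
  have h1 : 0 < Real.log 2 := Real.log_pos (by norm_num)
  have h2 : 1 < Real.sqrt 2 := by
    rw [Real.lt_sqrt (by norm_num)]; norm_num
  have h3 : 0 < Real.sqrt 2 - 1 := by linarith
  positivity

/-- With w = log(x²p/r), the sum is exactly √(4pr) cosh(w/2), so missing the optimal x² by a factor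
e^{±b} costs at most cosh(b/2). -/
lemma mul_add_div_le_sqrt_mul_cosh {p r x b : ℝ} (hp : 0 < p) (hr : 0 < r) (hx : 0 < x)
    (h1 : Real.exp (-b) ≤ x ^ 2 * p / r) (h2 : x ^ 2 * p / r ≤ Real.exp b) :
    p * x + r / x ≤ Real.sqrt (4 * p * r) * Real.cosh (b / 2) := by
  have hq : 0 < x ^ 2 * p / r := by positivity
  set w := Real.log (x ^ 2 * p / r) with hw
  have hw1 : -b ≤ w := by rwa [hw, Real.le_log_iff_exp_le hq]
  have hw2 : w ≤ b := by rwa [hw, Real.log_le_iff_le_exp hq]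
  have hcosh : Real.cosh (w / 2) ≤ Real.cosh (b / 2) := by
    rw [Real.cosh_le_cosh, abs_le]
    have : 0 ≤ b := by linarith
    rw [abs_of_nonneg (by linarith)]
    constructor <;> linarith
  have hS : Real.sqrt (4 * p * r) = 2 * Real.sqrt (p * r) := by
    rw [show 4 * p * r = 2 ^ 2 * (p * r) by ring, Real.sqrt_mul (by norm_num),
      Real.sqrt_sq (by norm_num)]
  have hexp : Real.exp (w / 2) = x * p / Real.sqrt (p * r) := by
    have : Real.exp (w / 2) = Real.sqrt (x ^ 2 * p / r) := by
      rw [← Real.exp_log hq, ← hw, ← Real.exp_half]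
    rw [this, show x ^ 2 * p / r = (x * p) ^ 2 / (p * r) by field_simp,
      Real.sqrt_div (by positivity), Real.sqrt_sq (by positivity)]
  have hexp' : Real.exp (-(w / 2)) = Real.sqrt (p * r) / (x * p) := by
    rw [Real.exp_neg, hexp, inv_div]
  have hspos : 0 < Real.sqrt (p * r) := Real.sqrt_pos.2 (by positivity)
  have hss : Real.sqrt (p * r) * Real.sqrt (p * r) = p * r := Real.mul_self_sqrt (by positivity)
  calc p * x + r / x = Real.sqrt (4 * p * r) * Real.cosh (w / 2) := by
        rw [Real.cosh_eq, hexp, hexp', hS]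
        field_simp
        rw [pow_two (√(p * r)), hss]
        ring
    _ ≤ _ := mul_le_mul_of_nonneg_left hcosh (Real.sqrt_nonneg _)

/-- In the variable u = α²v/λ this bounds r_λ/λ from above. The bound increases with u because λ ≤
1/2, and at u = 1 - z the error terms add up to less than z, with bz to spare. -/
lemma upper_profile_neg {κ lam A b e z u : ℝ} (hκ : 3 / 2 ≤ κ) (hlam : 0 < lam) (hA : 0 ≤ A)
    (hb : 0 < b) (hz : (κ - 1) * lam / 2 + e + A + b ≤ z) (he : 0 ≤ e) (hz8 : z ≤ 1 / 8)
    (hu0 : 0 ≤ u) (hu : u ≤ 1 - z) :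
    u - 1 + lam / 2 * (κ * u ^ 2 - 2 * u + 1) + A * u + e + b * (1 - z) < 0 := by
  have hm : (κ - 1) * lam / 2 ≤ 1 / 8 := by linarith
  have hlam2 : lam ≤ 1 / 2 := by nlinarith
  have hm0 : 0 < (κ - 1) * lam / 2 := by
    have : 0 < κ - 1 := by linarith
    positivity
  have hz0 : 0 < z := by linarith
  have h1 : u + lam / 2 * (κ * u ^ 2 - 2 * u)
      ≤ (1 - z) + lam / 2 * (κ * (1 - z) ^ 2 - 2 * (1 - z)) := by
    have h : 0 ≤ ((1 - z) - u) * (1 + lam / 2 * (κ * (u + (1 - z)) - 2)) := by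
      apply mul_nonneg (by linarith)
      have : 0 ≤ lam / 2 * (κ * (u + (1 - z))) := by
        have : 0 ≤ u + (1 - z) := by linarith
        positivity
      nlinarith
    nlinarith
  have h2 : A * u ≤ A * 1 := mul_le_mul_of_nonneg_left (by linarith) hA
  have h3 : lam / 2 * (κ * (1 - z) ^ 2 - 2 * (1 - z) + 1) ≤ (κ - 1) * lam / 2 := by
    have : κ * (1 - z) ^ 2 - 2 * (1 - z) + 1 ≤ κ - 1 := by
      -- The inequality κ ≤ 3(κ - 1) is the assumption κ ≥ 3/2.
      have : κ * z ^ 2 ≤ 3 * (κ - 1) * z ^ 2 :=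
        mul_le_mul_of_nonneg_right (by linarith) (sq_nonneg _)
      have : 0 ≤ (κ - 1) * (z * (2 - 3 * z)) :=
        mul_nonneg (by linarith) (mul_nonneg hz0.le (by linarith))
      nlinarith
    calc _ ≤ lam / 2 * (κ - 1) := mul_le_mul_of_nonneg_left this (by linarith)
      _ = _ := by ring
  have h4 : 0 < b * z := by positivity
  nlinarith

/-- At u = 1 + B every error term grows by a factor at most 1 + 4B, and B solves B = z(1 + 4B). For
the quadratic term this is 1 + 2B + 3B² ≤ 1 + 4B, valid since B ≤ 1/4. -/
lemma lower_profile_nonneg {κ lam A b b' e z B : ℝ} (hκ : 3 / 2 ≤ κ) (hlam : 0 < lam) (hA : 0 ≤ A)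
    (hb : b' ≤ b) (hb0 : 0 < b) (hz : (κ - 1) * lam / 2 + e + A + b ≤ z) (he : 0 ≤ e)
    (hz8 : z ≤ 1 / 8) (hB : B = z / (1 - 4 * z)) :
    lam / 2 * (κ * (1 + B) ^ 2 - 2 * (1 + B) + 1) + A * (1 + B) + e + b' * (1 + B) ≤ B := by
  have hm0 : 0 < (κ - 1) * lam / 2 := by
    have : 0 < κ - 1 := by linarith
    positivity
  have hz0 : 0 < z := by linarith
  have hBz : B = z * (1 + 4 * B) := by
    have : B * (1 - 4 * z) = z := by rw [hB]; exact div_mul_cancel₀ _ (by linarith)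
    linarith
  have hB0 : 0 ≤ B := by
    rw [hB]; exact div_nonneg hz0.le (by linarith)
  have hB4 : B ≤ 1 / 4 := by nlinarith
  have hBB : 3 * B ^ 2 ≤ 2 * B := by nlinarith
  have h1 : lam / 2 * (κ * (1 + B) ^ 2 - 2 * (1 + B) + 1)
      ≤ ((κ - 1) * lam / 2) * (1 + 4 * B) := by
    have : κ * (1 + B) ^ 2 - 2 * (1 + B) + 1 ≤ (κ - 1) * (1 + 4 * B) := by
      have : κ * B ^ 2 ≤ 3 * (κ - 1) * B ^ 2 :=
        mul_le_mul_of_nonneg_right (by linarith) (sq_nonneg _)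
      nlinarith
    calc _ ≤ lam / 2 * ((κ - 1) * (1 + 4 * B)) :=
          mul_le_mul_of_nonneg_left this (by linarith)
      _ = _ := by ring
  have h2 : A * (1 + B) ≤ A * (1 + 4 * B) := mul_le_mul_of_nonneg_left (by linarith) hA
  have h3 : e ≤ e * (1 + 4 * B) := by nlinarith
  have h4 : b' * (1 + B) ≤ b * (1 + 4 * B) := by
    calc b' * (1 + B) ≤ b * (1 + B) := mul_le_mul_of_nonneg_right hb (by linarith)
      _ ≤ _ := mul_le_mul_of_nonneg_left (by linarith) hb0.le
  have h5 : ((κ - 1) * lam / 2 + e + A + b) * (1 + 4 * B) ≤ z * (1 + 4 * B) :=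
    mul_le_mul_of_nonneg_right hz (by linarith)
  nlinarith

/-! ### Monotonicity of the truncated criterion -/

lemma truncation_arg_pos (t : ℝ) : 0 < 1 - t + t ^ 2 / 2 := by nlinarith [sq_nonneg (t - 1)]

lemma psi_mono : Monotone psi := by
  have key : ∀ s t : ℝ, 0 ≤ s → s ≤ t →
      -Real.log (1 - min s 1 + (min s 1) ^ 2 / 2) ≤ -Real.log (1 - min t 1 + (min t 1) ^ 2 / 2) := by
    intro s t hs hst
    apply neg_le_neg
    apply Real.log_le_log (truncation_arg_pos _)
    have h1 : min s 1 ≤ min t 1 := min_le_min_right _ hst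
    have h2 : min t 1 ≤ 1 := min_le_right _ _
    nlinarith
  have hnn : ∀ t : ℝ, 0 ≤ t → 0 ≤ -Real.log (1 - min t 1 + (min t 1) ^ 2 / 2) := by
    intro t ht
    have := key 0 t le_rfl ht
    simpa using this
  intro s t hst
  unfold psi
  split_ifs with h1 h2 h2
  · exact key s t h1 hst
  · linarith
  · have := hnn (-s) (by linarith)
    have := hnn t h2
    linarith
  · have := key (-t) (-s) (by linarith) (by linarith)
    linarith

lemma crit_mono_smul (lam : ℝ) (x : Fin n → Vec d) (θ : Vec d) {α₁ α₂ : ℝ} (h0 : 0 ≤ α₁)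
    (h : α₁ ≤ α₂) : crit lam x (α₁ • θ) ≤ crit lam x (α₂ • θ) := by
  unfold crit
  apply mul_le_mul_of_nonneg_left _ (by positivity)
  apply Finset.sum_le_sum
  intro i _
  apply psi_mono
  rw [real_inner_smul_left, real_inner_smul_left, mul_pow, mul_pow]
  have : α₁ ^ 2 ≤ α₂ ^ 2 := by gcongr
  have := mul_le_mul_of_nonneg_right this (sq_nonneg (inner ℝ θ (x i)))
  linarith

/-- If one scale `(lam, beta)` has precision `z` at level `t ≥ v`, then no element of the confidence
region lies far above `t`. -/
lemma sub_le_of_mem_region {κ s a ε lam beta v v' t z B : ℝ} {x : Fin n → Vec d} {θ : Vec d}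
    (hn : 0 < n) (hκ : 3 / 2 ≤ κ) (hs : 0 < s) (hlam : 0 < lam) (hbeta : 0 < beta)
    (hv : 0 ≤ v) (hvt : v ≤ t) (ht : 0 < t) (htv' : t < v')
    (hL : 0 ≤ Real.log ((gridSize n κ a : ℝ) / ε))
    (hz : (κ - 1) * lam / 2 + ((2 + 3 * cst) * s ^ 2 / (2 * beta ^ 2)
        + Real.log ((gridSize n κ a : ℝ) / ε) / n) / lam + (2 + cst) * Real.sqrt κ * s / beta
        + beta / (2 * n * t) ≤ z) (hz8 : z ≤ 1 / 8) (hB : B = z / (1 - 4 * z))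
    (h1 : ∀ α : ℝ, 0 < α → |crit lam x (α • θ) - (α ^ 2 * v - lam)|
      ≤ dev n κ s a ε lam beta α v)
    (h2 : ∀ α : ℝ, 0 < α → |crit lam x (α • θ) - (α ^ 2 * v' - lam)|
      ≤ dev n κ s a ε lam beta α v') :
    v' - t ≤ 2 * t * B := by
  have hc := cst_pos
  have hnR : (0 : ℝ) < n := by exact_mod_cast hn
  have hsκ : 0 < Real.sqrt κ := Real.sqrt_pos.2 (by linarith)
  set L := Real.log ((gridSize n κ a : ℝ) / ε) with hLdef
  set e3 := (2 + 3 * cst) * s ^ 2 / (2 * beta ^ 2) + L / n with he3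
  set A := (2 + cst) * Real.sqrt κ * s / beta with hA
  have he : 0 ≤ e3 / lam := by positivity
  have hA0 : 0 ≤ A := by positivity
  have hb0 : 0 < beta / (2 * n * t) := by positivity
  have hv'0 : 0 < v' := by linarith
  have hbb : beta / (2 * n * v') ≤ beta / (2 * n * t) := by gcongr
  have hm0 : 0 ≤ (κ - 1) * lam / 2 := by
    have : 0 ≤ κ - 1 := by linarith
    positivity
  have hz0 : 0 < z := by linarith
  have hB0 : 0 ≤ B := by
    rw [hB]; exact div_nonneg hz0.le (by linarith)
  -- Factoring out λ, with u = α²w/λ as variable, gives the form of the two profile lemmas.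
  have hdev : ∀ α w : ℝ, dev n κ s a ε lam beta α w
      = lam * (lam / 2 * (κ * (α ^ 2 * w / lam) ^ 2 - 2 * (α ^ 2 * w / lam) + 1)
        + A * (α ^ 2 * w / lam) + e3 / lam + beta * α ^ 2 / (2 * n * lam)) := by
    intro α w
    simp only [dev, hA, he3, ← hLdef]
    field_simp
    ring
  -- Chosen so that α₁²t/λ = 1 - z and α₂²v'/λ = 1 + B, where the profile lemmas apply.
  set α₁ := Real.sqrt ((1 - z) * lam / t) with hα₁
  set α₂ := Real.sqrt ((1 + B) * lam / v') with hα₂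
  have hp1 : 0 < (1 - z) * lam / t := div_pos (mul_pos (by linarith) hlam) ht
  have hp2 : 0 < (1 + B) * lam / v' := by positivity
  have hα₁s : α₁ ^ 2 = (1 - z) * lam / t := Real.sq_sqrt hp1.le
  have hα₂s : α₂ ^ 2 = (1 + B) * lam / v' := Real.sq_sqrt hp2.le
  have hα₁0 : 0 < α₁ := Real.sqrt_pos.2 hp1
  have hα₂0 : 0 < α₂ := Real.sqrt_pos.2 hp2
  have hneg : crit lam x (α₁ • θ) < 0 := by
    have h := (abs_le.1 (h1 α₁ hα₁0)).2
    rw [hdev] at h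
    have hu : α₁ ^ 2 * v / lam = (1 - z) * (v / t) := by
      rw [hα₁s]; field_simp
    have hvt1 : v / t ≤ 1 := (div_le_one ht).2 hvt
    have hvt0 : 0 ≤ v / t := by positivity
    have := upper_profile_neg (u := α₁ ^ 2 * v / lam) hκ hlam hA0 hb0 hz he hz8
      (by positivity) (by rw [hu]; nlinarith)
    have hbt : beta * α₁ ^ 2 / (2 * n * lam) = beta / (2 * n * t) * (1 - z) := by
      rw [hα₁s]; field_simp
    rw [hbt] at h
    have hmul := mul_neg_of_pos_of_neg hlam this
    have : α₁ ^ 2 * v = lam * (α₁ ^ 2 * v / lam) := by field_simp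
    linarith
  have hpos : 0 ≤ crit lam x (α₂ • θ) := by
    have h := (abs_le.1 (h2 α₂ hα₂0)).1
    rw [hdev] at h
    have hu : α₂ ^ 2 * v' / lam = 1 + B := by
      rw [hα₂s]; field_simp
    have := lower_profile_nonneg hκ hlam hA0 hbb hb0 hz he hz8 hB
    have hbt : beta * α₂ ^ 2 / (2 * n * lam) = beta / (2 * n * v') * (1 + B) := by
      rw [hα₂s]; field_simp
    rw [hbt, hu] at h
    have hmul := mul_le_mul_of_nonneg_left this hlam.le
    have : α₂ ^ 2 * v' = lam * (1 + B) := by rw [← hu]; field_simp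
    linarith
  have hlt : α₁ ≤ α₂ := by
    by_contra hcon
    have := crit_mono_smul lam x θ hα₂0.le (not_le.1 hcon).le
    linarith
  have hsq : α₁ ^ 2 ≤ α₂ ^ 2 := by gcongr
  rw [hα₁s, hα₂s, div_le_div_iff₀ ht hv'0] at hsq
  have hsq' : (1 - z) * v' ≤ (1 + B) * t := by
    have : lam * ((1 - z) * v') ≤ lam * ((1 + B) * t) := by linarith
    exact le_of_mul_le_mul_left this hlam
  have hBz : B = z * (1 + 4 * B) := by
    have : B * (1 - 4 * z) = z := by rw [hB]; exact div_mul_cancel₀ _ (by linarith)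
    linarith
  have h6 : (1 - z) * (v' - t) ≤ (1 - z) * (2 * t * B) := by
    have h7 : (1 - z) * (v' - t) ≤ (B + z) * t := by linarith
    have h8 : B + z ≤ (1 - z) * (2 * B) := by
      have : 0 ≤ z * B := by positivity
      linarith
    have := mul_le_mul_of_nonneg_right h8 ht.le
    linarith
  exact le_of_mul_le_mul_left h6 (by linarith)

/-! ### The grid of scales -/

lemma perspective_ratio_bounds {D L t τ b : ℝ} (hD : 0 < D) (hL : 0 ≤ L) (ht : 0 < t) (hτ : 0 < τ)
    (hb : 0 ≤ b) (h1 : τ ≤ t * Real.exp b) (h2 : t ≤ τ * Real.exp b) :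
    Real.exp (-b) ≤ (D / τ + L) / (D / t + L) ∧ (D / τ + L) / (D / t + L) ≤ Real.exp b := by
  have hE : 1 ≤ Real.exp b := Real.one_le_exp hb
  have key : ∀ x y : ℝ, 0 < x → 0 < y → y ≤ x * Real.exp b →
      D / x + L ≤ Real.exp b * (D / y + L) := by
    intro x y hx hy hxy
    have : D / x ≤ Real.exp b * (D / y) := by
      rw [div_le_iff₀ hx]
      calc D = D / y * y := by field_simp
        _ ≤ D / y * (x * Real.exp b) := by gcongr
        _ = _ := by ring
    nlinarith
  have p1 : 0 < D / t + L := by positivity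
  constructor
  · rw [le_div_iff₀ p1, Real.exp_neg, inv_mul_le_iff₀ (Real.exp_pos _)]
    exact key t τ ht hτ h1
  · rw [div_le_iff₀ p1]
    exact key τ t hτ ht h2

lemma lamGrid_pos {κ a ε : ℝ} (hn : 0 < n) (hκ : 3 / 2 ≤ κ)
    (hL : 0 < Real.log ((gridSize n κ a : ℝ) / ε)) (j : ℤ) : 0 < lamGrid n κ a ε j := by
  have hc := cst_pos
  have hnR : (0 : ℝ) < n := by exact_mod_cast hn
  have hsκ : 0 < Real.sqrt κ := Real.sqrt_pos.2 (by linarith)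
  have : 0 < κ - 1 := by linarith
  unfold lamGrid
  positivity

lemma betaGrid_pos {κ s : ℝ} (hn : 0 < n) (hκ : 3 / 2 ≤ κ) (hs : 0 < s) (a : ℝ) (j : ℤ) :
    0 < betaGrid n κ s a j := by
  have hc := cst_pos
  have hnR : (0 : ℝ) < n := by exact_mod_cast hn
  have hsκ : 0 < Real.sqrt κ := Real.sqrt_pos.2 (by linarith)
  unfold betaGrid
  positivity

/-- The left side is a sum px + r/x in λ plus one in β. The scale λ_j is optimal at the logarithmic
midpoint of the j-th cell, off by at most e^{a/2}, hence cosh(a/4); β_j is optimal at its upper end,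
off by at most e^a, hence cosh(a/2). Placing β_j at the upper end also keeps the 1/β² term below its
value at t, so that it fits in the first sum. -/
lemma grid_precision {κ s a ε t : ℝ} (hn : 0 < n) (hκ : 3 / 2 ≤ κ) (hs : 0 < s) (ha : 0 < a)
    (hL : 0 < Real.log ((gridSize n κ a : ℝ) / ε)) (ht : 0 < t) (j : ℤ)
    (h1 : s * Real.exp (-((j : ℝ) * a)) ≤ t) (h2 : t ≤ s * Real.exp (-((j : ℝ) - 1) * a)) :
    (κ - 1) * lamGrid n κ a ε j / 2 + ((2 + 3 * cst) * s ^ 2 / (2 * betaGrid n κ s a j ^ 2)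
        + Real.log ((gridSize n κ a : ℝ) / ε) / n) / lamGrid n κ a ε j
      + (2 + cst) * Real.sqrt κ * s / betaGrid n κ s a j
      + betaGrid n κ s a j / (2 * n * t) ≤ zeta n κ s a ε t / Real.sqrt n := by
  have hc := cst_pos
  have hnR : (0 : ℝ) < n := by exact_mod_cast hn
  have hsκ : 0 < Real.sqrt κ := Real.sqrt_pos.2 (by linarith)
  have hκ1 : 0 < κ - 1 := by linarith
  have hlam := lamGrid_pos (a := a) (ε := ε) hn hκ hL j
  have hbeta := betaGrid_pos (a := a) hn hκ hs j
  set L := Real.log ((gridSize n κ a : ℝ) / ε) with hLdef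
  set lam := lamGrid n κ a ε j with hlamdef
  set beta := betaGrid n κ s a j with hbetadef
  set D := (2 + 3 * cst) * s / (4 * (2 + cst) * Real.sqrt κ) with hD
  have hD0 : 0 < D := by positivity
  set τ := s * Real.exp (-((j : ℝ) - 1) * a) with hτ
  have hτ0 : 0 < τ := by positivity
  set τ' := s * Real.exp (-((j : ℝ) - 1 / 2) * a) with hτ'
  have hτ'0 : 0 < τ' := by positivity
  have hbeta2 : beta ^ 2 = 2 * (2 + cst) * Real.sqrt κ * s * n * τ := by
    rw [hbetadef, betaGrid, Real.sq_sqrt (by positivity), hτ]; ring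
  have hlam2 : lam ^ 2 = 2 / (n * (κ - 1)) * (D / τ' + L) := by
    rw [hlamdef, lamGrid, Real.sq_sqrt (by positivity), hτ', hD]
    congr 2
    field_simp
  have hτt : τ ≤ t * Real.exp a := by
    calc τ = s * Real.exp (-((j : ℝ) * a)) * Real.exp a := by
          rw [hτ, mul_assoc, ← Real.exp_add]; ring_nf
      _ ≤ _ := by gcongr
  have hτ't : τ' ≤ t * Real.exp (a / 2) := by
    calc τ' = s * Real.exp (-((j : ℝ) * a)) * Real.exp (a / 2) := by
          rw [hτ', mul_assoc, ← Real.exp_add]; ring_nf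
      _ ≤ _ := by gcongr
  have htτ' : t ≤ τ' * Real.exp (a / 2) := by
    calc t ≤ τ := h2
      _ = _ := by rw [hτ', hτ, mul_assoc, ← Real.exp_add]; ring_nf
  have hM : 0 < D / t + L := by positivity
  have part1 : (κ - 1) * lam / 2 + ((2 + 3 * cst) * s ^ 2 / (2 * beta ^ 2) + L / n) / lam
      ≤ Real.sqrt (2 * (κ - 1) * (D / t + L) / n) * Real.cosh (a / 4) := by
    have he : (2 + 3 * cst) * s ^ 2 / (2 * beta ^ 2) + L / n ≤ (D / t + L) / n := by
      have : (2 + 3 * cst) * s ^ 2 / (2 * beta ^ 2) = D / τ / n := by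
        rw [hbeta2, hD]; field_simp; ring
      rw [this, add_div]
      gcongr
    have hr : lam ^ 2 * ((κ - 1) / 2) / ((D / t + L) / n) = (D / τ' + L) / (D / t + L) := by
      rw [hlam2]; field_simp
    obtain ⟨b1, b2⟩ := perspective_ratio_bounds hD0 hL.le ht hτ'0 (by positivity) hτ't htτ'
    have := mul_add_div_le_sqrt_mul_cosh (p := (κ - 1) / 2) (r := (D / t + L) / n) (x := lam)
      (b := a / 2) (by positivity) (by positivity) hlam (by rw [hr]; exact b1)
      (by rw [hr]; exact b2)
    calc _ ≤ (κ - 1) / 2 * lam + (D / t + L) / n / lam := by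
          have := div_le_div_of_nonneg_right he hlam.le
          linarith
      _ ≤ _ := this
      _ = _ := by
          congr 2
          · ring
          · ring
  have part2 : (2 + cst) * Real.sqrt κ * s / beta + beta / (2 * n * t)
      ≤ Real.sqrt (2 * (2 + cst) * Real.sqrt κ * s / t / n) * Real.cosh (a / 2) := by
    have hr : beta ^ 2 * (1 / (2 * n * t)) / ((2 + cst) * Real.sqrt κ * s) = τ / t := by
      rw [hbeta2]; field_simp
    have := mul_add_div_le_sqrt_mul_cosh (p := 1 / (2 * n * t))
      (r := (2 + cst) * Real.sqrt κ * s) (x := beta)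
      (b := a) (by positivity) (by positivity) hbeta
      (by
        rw [hr, le_div_iff₀ ht]
        calc Real.exp (-a) * t ≤ 1 * t := by
              gcongr; exact Real.exp_le_one_iff.2 (by linarith)
          _ ≤ τ := by rw [one_mul]; exact h2)
      (by rw [hr, div_le_iff₀ ht]; linarith)
    calc _ = 1 / (2 * n * t) * beta + (2 + cst) * Real.sqrt κ * s / beta := by ring
      _ ≤ _ := this
      _ = _ := by
          congr 2
          field_simp; ring
  have hz : zeta n κ s a ε t / Real.sqrt n
      = Real.sqrt (2 * (κ - 1) * (D / t + L) / n) * Real.cosh (a / 4)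
        + Real.sqrt (2 * (2 + cst) * Real.sqrt κ * s / t / n) * Real.cosh (a / 2) := by
    rw [Real.sqrt_div (by positivity), Real.sqrt_div (by positivity), zeta, ← hLdef, hD]
    rw [show (2 + 3 * cst) * s / (4 * (2 + cst) * √κ * t)
      = (2 + 3 * cst) * s / (4 * (2 + cst) * √κ) / t by field_simp]
    ring
  rw [hz]
  linarith

lemma zeta_pos {κ s a ε t : ℝ} (hκ : 3 / 2 ≤ κ) (hs : 0 < s) (ht : 0 < t) :
    0 < zeta n κ s a ε t := by
  have hc := cst_pos
  have hsκ : 0 < Real.sqrt κ := Real.sqrt_pos.2 (by linarith)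
  have h1 := Real.cosh_pos (a / 4)
  have h2 := Real.cosh_pos (a / 2)
  unfold zeta
  have : 0 < Real.sqrt (2 * (2 + cst) * Real.sqrt κ * s / t) := Real.sqrt_pos.2 (by positivity)
  positivity

lemma zeta_anti {κ s a ε t t' : ℝ} (hκ : 3 / 2 ≤ κ) (hs : 0 < s) (ht : 0 < t) (htt : t ≤ t') :
    zeta n κ s a ε t' ≤ zeta n κ s a ε t := by
  have hc := cst_pos
  have hsκ : 0 < Real.sqrt κ := Real.sqrt_pos.2 (by linarith)
  have h1 := Real.cosh_pos (a / 4)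
  have h2 := Real.cosh_pos (a / 2)
  have h3 : 0 ≤ κ - 1 := by linarith
  have h4 : 0 < 2 + 3 * cst := by linarith
  have h5 : 0 < 2 + cst := by linarith
  unfold zeta
  gcongr

/-- The factor √t cancels every 1/t under the roots; only the logarithmic term still depends on t,
and it grows. -/
lemma sqrt_mul_zeta_mono {κ s a ε t t' : ℝ} (hκ : 3 / 2 ≤ κ) (hs : 0 < s) (ht : 0 < t)
    (htt : t ≤ t') (hL : 0 < Real.log ((gridSize n κ a : ℝ) / ε)) :
    Real.sqrt t * zeta n κ s a ε t ≤ Real.sqrt t' * zeta n κ s a ε t' := by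
  have hc := cst_pos
  have hsκ : 0 < Real.sqrt κ := Real.sqrt_pos.2 (by linarith)
  have h1 := Real.cosh_pos (a / 4)
  have h3 : 0 ≤ κ - 1 := by linarith
  have key : ∀ u : ℝ, 0 < u → Real.sqrt u * zeta n κ s a ε u
      = Real.sqrt (2 * (κ - 1) * ((2 + 3 * cst) * s / (4 * (2 + cst) * Real.sqrt κ)
        + Real.log ((gridSize n κ a : ℝ) / ε) * u)) * Real.cosh (a / 4)
      + Real.sqrt (2 * (2 + cst) * Real.sqrt κ * s) * Real.cosh (a / 2) := by
    intro u hu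
    unfold zeta
    rw [mul_add, ← mul_assoc, ← mul_assoc, ← Real.sqrt_mul hu.le, ← Real.sqrt_mul hu.le]
    congr 3
    · field_simp
    · field_simp
  rw [key t ht, key t' (by linarith)]
  gcongr

/-! ### The relative error bound -/

/-- The finite value of `B_*` at a level above the threshold. -/
def relErr (n : ℕ) (κ s a ε t : ℝ) : ℝ :=
  (zeta n κ s a ε t / Real.sqrt n) / (1 - 4 * (zeta n κ s a ε t / Real.sqrt n))

section
variable {κ s a ε σ : ℝ}

lemma natCast_pos_of_zeta_le (hκ : 3 / 2 ≤ κ) (hs : 0 < s) (hσ : 0 < σ)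
    (hζ : 8 * zeta n κ s a ε σ ≤ Real.sqrt n) : 0 < n := by
  by_contra h
  have : n = 0 := by omega
  have hz := zeta_pos (n := n) (a := a) (ε := ε) hκ hs hσ
  rw [this] at hζ hz
  simp at hζ
  linarith

lemma zeta_div_sqrt_le (hκ : 3 / 2 ≤ κ) (hs : 0 < s) (hσ : 0 < σ)
    (hζ : 8 * zeta n κ s a ε σ ≤ Real.sqrt n) {t : ℝ} (ht : σ ≤ t) :
    zeta n κ s a ε t / Real.sqrt n ≤ 1 / 8 := by
  have hn : (0 : ℝ) < n := by exact_mod_cast natCast_pos_of_zeta_le hκ hs hσ hζ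
  have := zeta_anti (n := n) (a := a) (ε := ε) hκ hs hσ ht
  rw [div_le_iff₀ (Real.sqrt_pos.2 hn)]
  linarith

/-- From κ ≥ 3/2 one gets 6 + (κ-1)⁻¹ ≤ 8, so the assumption at σ and the monotonicity of ζ rule out
the infinite branch. -/
lemma Bstar_eq_relErr (hκ : 3 / 2 ≤ κ) (hs : 0 < s) (hσ : 0 < σ)
    (hζ : 8 * zeta n κ s a ε σ ≤ Real.sqrt n) (t : ℝ) :
    Bstar n κ s a ε σ t = (relErr n κ s a ε (max t σ) : EReal) := by
  have h1 := zeta_anti (n := n) (a := a) (ε := ε) hκ hs hσ (le_max_right t σ)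
  have h2 := zeta_pos (n := n) (a := a) (ε := ε) hκ hs (lt_max_of_lt_right (b := t) hσ)
  have h3 : (κ - 1)⁻¹ ≤ 2 := by
    rw [inv_le_comm₀ (by linarith) (by norm_num)]; linarith
  rw [Bstar, if_pos, relErr]
  nlinarith

lemma relErr_nonneg (hκ : 3 / 2 ≤ κ) (hs : 0 < s) (hσ : 0 < σ)
    (hζ : 8 * zeta n κ s a ε σ ≤ Real.sqrt n) {t : ℝ} (ht : σ ≤ t) :
    0 ≤ relErr n κ s a ε t := by
  have h1 := zeta_div_sqrt_le hκ hs hσ hζ ht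
  have h2 := zeta_pos (n := n) (a := a) (ε := ε) hκ hs (hσ.trans_le ht)
  unfold relErr
  apply div_nonneg (by positivity)
  linarith

/-- With t = r², the quantity is (rz) · r/(1-4z). The first factor increases by
`sqrt_mul_zeta_mono`; the second does too, because z ≤ 1/8. -/
lemma mul_relErr_mono (hκ : 3 / 2 ≤ κ) (hs : 0 < s) (hσ : 0 < σ)
    (hL : 0 < Real.log ((gridSize n κ a : ℝ) / ε))
    (hζ : 8 * zeta n κ s a ε σ ≤ Real.sqrt n) {t t' : ℝ} (ht : σ ≤ t) (htt : t ≤ t') :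
    t * relErr n κ s a ε t ≤ t' * relErr n κ s a ε t' := by
  have hn : (0 : ℝ) < n := by exact_mod_cast natCast_pos_of_zeta_le hκ hs hσ hζ
  have ht0 : 0 < t := hσ.trans_le ht
  have ht'0 : 0 < t' := ht0.trans_le htt
  have hsn := Real.sqrt_pos.2 hn
  have hz8 := zeta_div_sqrt_le hκ hs hσ hζ ht
  have hz8' := zeta_div_sqrt_le hκ hs hσ hζ (ht.trans htt)
  have hm := div_le_div_of_nonneg_right
    (sqrt_mul_zeta_mono (n := n) (a := a) (ε := ε) hκ hs ht0 htt hL) hsn.le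
  rw [mul_div_assoc, mul_div_assoc] at hm
  unfold relErr
  have hz0 : 0 < zeta n κ s a ε t / Real.sqrt n := div_pos (zeta_pos hκ hs ht0) hsn
  have hz0' : 0 < zeta n κ s a ε t' / Real.sqrt n := div_pos (zeta_pos hκ hs ht'0) hsn
  generalize zeta n κ s a ε t / Real.sqrt n = z at *
  generalize zeta n κ s a ε t' / Real.sqrt n = z' at *
  obtain ⟨r, hr, rfl⟩ : ∃ r, 0 < r ∧ r ^ 2 = t := ⟨√t, Real.sqrt_pos.2 ht0, Real.sq_sqrt ht0.le⟩
  obtain ⟨r', hr', rfl⟩ : ∃ r, 0 < r ∧ r ^ 2 = t' :=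
    ⟨√t', Real.sqrt_pos.2 ht'0, Real.sq_sqrt ht'0.le⟩
  rw [Real.sqrt_sq hr.le, Real.sqrt_sq hr'.le] at hm
  have hrr : r ≤ r' := by
    by_contra h
    nlinarith
  -- Here 4z(r' + r) ≤ (r' + r)/2 ≤ r'.
  have h1 : 0 ≤ (r' - r) * (r' - 4 * z * (r' + r)) := mul_nonneg (by linarith) (by nlinarith)
  have h2 : r * (1 - 4 * z') ≤ r' * (1 - 4 * z) := by
    refine le_of_mul_le_mul_left ?_ hr'
    have := mul_le_mul_of_nonneg_left hm hr.le
    nlinarith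
  rw [mul_div_assoc', mul_div_assoc', div_le_div_iff₀ (by linarith) (by linarith)]
  calc r ^ 2 * z * (1 - 4 * z') = r * z * (r * (1 - 4 * z')) := by ring
    _ ≤ r * z * (r' * (1 - 4 * z)) := by gcongr
    _ ≤ r' * z' * (r' * (1 - 4 * z)) := by
        have : 0 ≤ r' * (1 - 4 * z) := mul_nonneg hr'.le (by linarith)
        gcongr
    _ = _ := by ring

/-- The grid covers the levels between the threshold `σ` and `s`. -/
lemma exists_grid_index (hκ : 3 / 2 ≤ κ) (hs : 0 < s) (ha : 0 < a) (hσ : 0 < σ)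
    (hζ : 8 * zeta n κ s a ε σ ≤ Real.sqrt n) {t : ℝ} (ht : σ ≤ t) (hts : t ≤ s) :
    ∃ j : ℤ, 1 ≤ j ∧ j ≤ gridSize n κ a ∧ s * Real.exp (-((j : ℝ) * a)) ≤ t ∧
      t ≤ s * Real.exp (-((j : ℝ) - 1) * a) := by
  have hc := cst_pos
  have hsκ : 0 < Real.sqrt κ := Real.sqrt_pos.2 (by linarith)
  have ht0 : 0 < t := hσ.trans_le ht
  have hn : (0 : ℝ) < n := by exact_mod_cast natCast_pos_of_zeta_le hκ hs hσ hζ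
  -- Position of t on the logarithmic grid: cell j is j - 1 ≤ y ≤ j, whence the index ⌊y⌋ + 1.
  set y := a⁻¹ * Real.log (s / t) with hy
  have hay : a * y = Real.log (s / t) := by rw [hy]; field_simp
  have hst : s / t = Real.exp (a * y) := by rw [hay, Real.exp_log (by positivity)]
  have hts' : t = s * Real.exp (-(a * y)) := by
    rw [Real.exp_neg, ← hst]; field_simp
  have hy0 : 0 ≤ y := by
    apply mul_nonneg (by positivity)
    exact Real.log_nonneg ((one_le_div ht0).2 hts)
  -- The last root in ζ(σ) alone yields 128(2+c)√κ s/σ ≤ n, more than the constant 72 in K requires.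
  have hratio : s / t ≤ n / (72 * (2 + cst) * Real.sqrt κ) := by
    have h1 : Real.sqrt (2 * (2 + cst) * Real.sqrt κ * s / σ) ≤ zeta n κ s a ε σ := by
      unfold zeta
      have h2 := Real.one_le_cosh (a / 2)
      have h3 := Real.cosh_pos (a / 4)
      have h4 := Real.sqrt_nonneg (2 * (2 + cst) * Real.sqrt κ * s / σ)
      have h5 : 0 ≤ Real.sqrt (2 * (κ - 1) *
        ((2 + 3 * cst) * s / (4 * (2 + cst) * Real.sqrt κ * σ)
        + Real.log ((gridSize n κ a : ℝ) / ε))) * Real.cosh (a / 4) := by positivity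
      nlinarith
    have h2 : 8 * Real.sqrt (2 * (2 + cst) * Real.sqrt κ * s / σ) ≤ Real.sqrt n := by linarith
    have h3 : (8 * Real.sqrt (2 * (2 + cst) * Real.sqrt κ * s / σ)) ^ 2 ≤ Real.sqrt n ^ 2 := by
      gcongr
    rw [mul_pow, Real.sq_sqrt (by positivity), Real.sq_sqrt hn.le] at h3
    calc s / t ≤ s / σ := by gcongr
      _ ≤ _ := by
        rw [le_div_iff₀ (by positivity)]
        have : 0 < (2 + cst) * Real.sqrt κ * (s / σ) := by positivity
        have e : 2 * (2 + cst) * Real.sqrt κ * s / σ = 2 * ((2 + cst) * Real.sqrt κ * (s / σ)) := by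
          ring
        rw [e] at h3
        nlinarith
  have hyK : y ≤ ⌈a⁻¹ * Real.log ((n : ℝ) / (72 * (2 + cst) * Real.sqrt κ))⌉ := by
    refine le_trans ?_ (Int.le_ceil _)
    rw [hy]
    gcongr
  refine ⟨⌊y⌋ + 1, ?_, ?_, ?_, ?_⟩
  · have := Int.floor_nonneg.2 hy0
    omega
  · unfold gridSize
    have : ⌊y⌋ ≤ ⌈a⁻¹ * Real.log ((n : ℝ) / (72 * (2 + cst) * Real.sqrt κ))⌉ := by
      have := (Int.floor_le y).trans hyK
      exact_mod_cast this
    omega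
  · rw [hts']
    have := (Int.lt_floor_add_one y).le
    push_cast
    gcongr s * Real.exp ?_
    nlinarith
  · rw [hts']
    have := Int.floor_le y
    push_cast
    gcongr s * Real.exp ?_
    nlinarith

lemma sub_le_of_mem_confRegion (hκ : 3 / 2 ≤ κ) (hs : 0 < s) (ha : 0 < a) (hσ : 0 < σ)
    (hL : 0 < Real.log ((gridSize n κ a : ℝ) / ε))
    (hζ : 8 * zeta n κ s a ε σ ≤ Real.sqrt n) {x : Fin n → Vec d} {θ : Vec d} {v v' : ℝ}
    (hv : v ∈ confRegion κ s a ε x θ) (hv' : v' ∈ confRegion κ s a ε x θ)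
    (hvs : max v σ ≤ s) (hlt : max v σ < v') :
    v' - max v σ ≤ 2 * (max v σ * relErr n κ s a ε (max v σ)) := by
  have hn := natCast_pos_of_zeta_le hκ hs hσ hζ
  have ht0 : 0 < max v σ := lt_max_of_lt_right hσ
  obtain ⟨j, hj1, hjK, h1, h2⟩ := exists_grid_index hκ hs ha hσ hζ (le_max_right v σ) hvs
  have := sub_le_of_mem_region hn hκ hs (lamGrid_pos hn hκ hL j) (betaGrid_pos hn hκ hs a j) hv.1
    (le_max_left v σ) ht0 hlt hL.le (grid_precision hn hκ hs ha hL ht0 j h1 h2)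
    (zeta_div_sqrt_le hκ hs hσ hζ (le_max_right v σ)) rfl (hv.2 j hj1 hjK) (hv'.2 j hj1 hjK)
  rw [relErr]
  linarith

/-- Monotonicity is used up to min(T, s) only; beyond, just the prefactor is enlarged. The estimator
may have values above s, where `Bstar` is evaluated at s. -/
lemma mul_relErr_le_mul_min (hκ : 3 / 2 ≤ κ) (hs : 0 < s) (hσ : 0 < σ)
    (hL : 0 < Real.log ((gridSize n κ a : ℝ) / ε))
    (hζ : 8 * zeta n κ s a ε σ ≤ Real.sqrt n) (hσs : σ ≤ s) {t T : ℝ} (ht : σ ≤ t) (hts : t ≤ s)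
    (htT : t ≤ T) :
    t * relErr n κ s a ε t ≤ T * relErr n κ s a ε (min T s) := by
  refine (mul_relErr_mono hκ hs hσ hL hζ ht (le_min htT hts)).trans ?_
  apply mul_le_mul_of_nonneg_right (min_le_left _ _)
  exact relErr_nonneg hκ hs hσ hζ (le_min (ht.trans htT) hσs)

/-- Two elements of a confidence region, the first one at most `s`, are close to each other, relative
to any upper bound of either of them. -/
lemma abs_sub_le_of_mem_confRegion (hκ : 3 / 2 ≤ κ) (hs : 0 < s) (ha : 0 < a) (hσ : 0 < σ)
    (hL : 0 < Real.log ((gridSize n κ a : ℝ) / ε)) (hσs : σ ≤ s)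
    (hζ : 8 * zeta n κ s a ε σ ≤ Real.sqrt n) {x : Fin n → Vec d} {θ : Vec d} {v v' T : ℝ}
    (hv : v ∈ confRegion κ s a ε x θ) (hv' : v' ∈ confRegion κ s a ε x θ)
    (hvs : v ≤ s) (hT : v ≤ T ∨ v' ≤ T) :
    |max v σ - max v' σ|
      ≤ 2 * (max T σ * relErr n κ s a ε (max (min T s) σ)) := by
  have hmin : max (min T s) σ = min (max T σ) s := by
    rw [max_min_distrib_right, max_eq_left hσs]
  have hvs' : max v σ ≤ s := max_le hvs hσs
  have hT0 : 0 ≤ max T σ * relErr n κ s a ε (max (min T s) σ) :=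
    mul_nonneg (hσ.le.trans (le_max_right _ _))
      (relErr_nonneg hκ hs hσ hζ (le_max_right _ _))
  have bound : ∀ t, σ ≤ t → t ≤ s → t ≤ max T σ →
      t * relErr n κ s a ε t ≤ max T σ * relErr n κ s a ε (max (min T s) σ) := by
    intro t h1 h2 h3
    rw [hmin]
    exact mul_relErr_le_mul_min hκ hs hσ hL hζ hσs h1 h2 h3
  -- The smaller of the two truncated values is the reference level: it is at most s since v ≤ s,
  -- and at most max T σ whichever of v, v' is bounded by T.
  rcases lt_trichotomy (max v σ) (max v' σ) with h | h | h
  · have hlt : max v σ < v' := by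
      rcases lt_max_iff.1 h with h | h
      · exact h
      · exact absurd (le_max_right v σ) (not_le.2 h)
    have hv'm : max v' σ = v' := max_eq_left ((le_max_right v σ).trans hlt.le)
    have h1 := sub_le_of_mem_confRegion hκ hs ha hσ hL hζ hv hv' hvs' hlt
    have h2 := bound (max v σ) (le_max_right _ _) hvs' (by
      rcases hT with hT | hT
      · exact max_le_max_right _ hT
      · exact (hlt.le.trans hT).trans (le_max_left _ _))
    rw [abs_sub_comm, hv'm, abs_of_nonneg (by linarith)]
    linarith
  · rw [h, sub_self, abs_zero]
    linarith
  · have hlt : max v' σ < v := by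
      rcases lt_max_iff.1 h with h | h
      · exact h
      · exact absurd (le_max_right v' σ) (not_le.2 h)
    have hvm : max v σ = v := max_eq_left ((le_max_right v' σ).trans hlt.le)
    have h1 := sub_le_of_mem_confRegion hκ hs ha hσ hL hζ hv' hv (hlt.le.trans hvs) hlt
    have h2 := bound (max v' σ) (le_max_right _ _) (hlt.le.trans hvs) (by
      rcases hT with hT | hT
      · exact (hlt.le.trans hT).trans (le_max_left _ _)
      · exact max_le_max_right _ hT)
    rw [hvm, abs_of_nonneg (by linarith)]
    linarith

end

/-! ### Eigenvalues and quadratic forms -/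

lemma eig_antitone (M : Matrix (Fin d) (Fin d) ℝ) (hM : M.IsHermitian) : Antitone (eig M hM) := by
  intro i j hij
  exact hM.eigenvalues₀_antitone (by simpa using hij)

/-- The roots of the characteristic polynomial of f(M) are the images of the eigenvalues; a monotone
f keeps them in decreasing order, so the sorted lists agree. -/
lemma eig_cfc_of_monotone (M : Matrix (Fin d) (Fin d) ℝ) (hM : M.IsHermitian) {f : ℝ → ℝ}
    (hf : Monotone f) (hf' : (cfc f M).IsHermitian) (i : Fin d) :
    eig (cfc f M) hf' i = f (eig M hM i) := by
  have h1 := hf'.sort_roots_charpoly_eq_eigenvalues₀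
  have h2 : (cfc f M).charpoly.roots
      = Multiset.map (f ∘ hM.eigenvalues₀) Finset.univ.val := by
    rw [hM.charpoly_cfc_eq, Polynomial.roots_prod _ _
      (Finset.prod_ne_zero_iff.2 fun _ _ => Polynomial.X_sub_C_ne_zero _)]
    simp only [Polynomial.roots_X_sub_C, Multiset.bind_singleton]
    simp only [Matrix.IsHermitian.eigenvalues]
    conv_rhs => rw [← Multiset.map_univ_val_equiv
      (Fintype.equivOfCardEq (Fintype.card_fin (Fintype.card (Fin d)))).symm, Multiset.map_map]
    rfl
  have h3 : (((cfc f M).charpoly.roots.map RCLike.re).sort (· ≥ ·))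
      = List.ofFn (f ∘ hM.eigenvalues₀) := by
    rw [h2]
    simp only [Fin.univ_val_map, Multiset.map_coe, List.map_ofFn, Function.comp_def, RCLike.re_to_real,
      Multiset.coe_sort]
    apply List.mergeSort_of_pairwise
    simp_rw [decide_eq_true_eq, ← List.sortedGE_iff_pairwise]
    exact (hf.comp_antitone hM.eigenvalues₀_antitone).sortedGE_ofFn
  rw [h1] at h3
  exact congrFun (List.ofFn_injective h3) _

lemma eig_positivePart (Q : Matrix (Fin d) (Fin d) ℝ) (hQ : Q.IsHermitian) (i : Fin d) :
    eig (positivePart Q) (positivePart_isHermitian Q) i = max (eig Q hQ i) 0 :=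
  eig_cfc_of_monotone Q hQ (fun _ _ h => max_le_max_right 0 h) _ i

lemma quad_eq_inner (M : Matrix (Fin d) (Fin d) ℝ) (θ : Vec d) :
    quad M θ = inner ℝ θ (Matrix.toEuclideanLin M θ) := by
  simp [quad, PiLp.inner_apply, Matrix.toLpLin_apply, Matrix.mulVec, dotProduct, Finset.mul_sum,
    mul_assoc, mul_comm, mul_left_comm]

lemma exists_orthonormalBasis_quad (M : Matrix (Fin d) (Fin d) ℝ) (hM : M.IsHermitian) :
    ∃ b : OrthonormalBasis (Fin d) ℝ (Vec d),
      ∀ θ, quad M θ = ∑ k, eig M hM k * (inner ℝ (b k) θ) ^ 2 := by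
  have hs := Matrix.isSymmetric_toEuclideanLin_iff.mpr hM
  let b₀ := hs.eigenvectorBasis finrank_euclideanSpace
  refine ⟨b₀.reindex (finCongr (Fintype.card_fin d)), fun θ => ?_⟩
  rw [quad_eq_inner, ← (b₀.reindex (finCongr (Fintype.card_fin d))).sum_inner_mul_inner]
  refine Finset.sum_congr rfl fun k _ => ?_
  have h : Matrix.toEuclideanLin M (b₀.reindex (finCongr (Fintype.card_fin d)) k)
      = eig M hM k • b₀.reindex (finCongr (Fintype.card_fin d)) k := by
    have := hs.apply_eigenvectorBasis finrank_euclideanSpace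
      (k.cast (Fintype.card_fin d).symm)
    rw [OrthonormalBasis.reindex_apply]
    exact this
  rw [← hs, h, real_inner_smul_left, real_inner_comm]
  ring

lemma quad_le_eig_zero [NeZero d] (M : Matrix (Fin d) (Fin d) ℝ) (hM : M.IsHermitian) {θ : Vec d}
    (hθ : ‖θ‖ = 1) : quad M θ ≤ eig M hM 0 := by
  obtain ⟨b, hb⟩ := exists_orthonormalBasis_quad M hM
  calc quad M θ = ∑ k, eig M hM k * (inner ℝ (b k) θ) ^ 2 := hb θ
    _ ≤ ∑ k, eig M hM 0 * (inner ℝ (b k) θ) ^ 2 := by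
        gcongr with k
        exact eig_antitone M hM (Fin.zero_le k)
    _ = _ := by rw [← Finset.mul_sum, b.sum_sq_inner_right, hθ]; simp

lemma exists_quad_eq_eig (M : Matrix (Fin d) (Fin d) ℝ) (hM : M.IsHermitian) (i : Fin d) :
    ∃ θ : Vec d, ‖θ‖ = 1 ∧ quad M θ = eig M hM i := by
  obtain ⟨b, hb⟩ := exists_orthonormalBasis_quad M hM
  refine ⟨b i, b.norm_eq_one i, ?_⟩
  simp [hb, OrthonormalBasis.inner_eq_ite]

/-- Courant–Fischer: a uniform comparison of quadratic forms passes to the eigenvalues. -/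
lemma eig_compare {A B : Matrix (Fin d) (Fin d) ℝ} (hA : A.IsHermitian) (hB : B.IsHermitian)
    {φ : ℝ → ℝ} (hφ : Monotone φ) {η : ℝ}
    (h : ∀ θ : Vec d, ‖θ‖ = 1 → φ (quad A θ) ≤ φ (quad B θ) + η) (i : Fin d) :
    φ (eig A hA i) ≤ φ (eig B hB i) + η := by
  obtain ⟨a, ha⟩ := exists_orthonormalBasis_quad A hA
  obtain ⟨b, hb⟩ := exists_orthonormalBasis_quad B hB
  -- These are d - 1 linear conditions, hence a nonzero common kernel vector: orthogonal to a_k for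
  -- k > i and to b_k for k < i. There the form of A only sees eigenvalues at least its i-th, that
  -- of B only eigenvalues at most its i-th.
  let L : Vec d →ₗ[ℝ] ({k : Fin d // k ≠ i} → ℝ) :=
    LinearMap.pi fun k => (innerₛₗ ℝ (if i < k.1 then a k else b k) : Vec d →ₗ[ℝ] ℝ)
  have hker : LinearMap.ker L ≠ ⊥ := by
    apply LinearMap.ker_ne_bot_of_finrank_lt
    rw [Module.finrank_fintype_fun_eq_card, finrank_euclideanSpace_fin]
    have := i.pos
    simp [Fintype.card_subtype_compl]
    omega
  obtain ⟨y, hy, hy0⟩ := (Submodule.ne_bot_iff _).1 hker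
  have hyn : ‖y‖ ≠ 0 := norm_ne_zero_iff.2 hy0
  let θ : Vec d := ‖y‖⁻¹ • y
  have hθ : ‖θ‖ = 1 := by simp [θ, norm_smul, hyn]
  have hLθ : ∀ k : Fin d, k ≠ i → inner ℝ (if i < k then a k else b k) θ = 0 := by
    intro k hk
    have := congrFun (LinearMap.mem_ker.1 hy) ⟨k, hk⟩
    simp only [L, LinearMap.pi_apply, innerₛₗ_apply_apply, Pi.zero_apply] at this
    simp [θ, real_inner_smul_right, this]
  have hqa : eig A hA i ≤ quad A θ := by
    calc eig A hA i = ∑ k, eig A hA i * (inner ℝ (a k) θ) ^ 2 := by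
          rw [← Finset.mul_sum, a.sum_sq_inner_right, hθ]; simp
      _ ≤ ∑ k, eig A hA k * (inner ℝ (a k) θ) ^ 2 := by
          refine Finset.sum_le_sum fun k _ => ?_
          by_cases hk : i < k
          · have := hLθ k hk.ne'
            rw [if_pos hk] at this
            simp [this]
          · exact mul_le_mul_of_nonneg_right (eig_antitone A hA (not_lt.1 hk)) (sq_nonneg _)
      _ = _ := (ha θ).symm
  have hqb : quad B θ ≤ eig B hB i := by
    calc quad B θ = ∑ k, eig B hB k * (inner ℝ (b k) θ) ^ 2 := hb θ
      _ ≤ ∑ k, eig B hB i * (inner ℝ (b k) θ) ^ 2 := by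
          refine Finset.sum_le_sum fun k _ => ?_
          by_cases hk : k < i
          · have := hLθ k hk.ne
            rw [if_neg hk.not_gt] at this
            simp [this]
          · exact mul_le_mul_of_nonneg_right (eig_antitone B hB (not_lt.1 hk)) (sq_nonneg _)
      _ = _ := by rw [← Finset.mul_sum, b.sum_sq_inner_right, hθ]; simp
  calc φ (eig A hA i) ≤ φ (quad A θ) := hφ hqa
    _ ≤ φ (quad B θ) + η := h θ hθ
    _ ≤ _ := by
      have := hφ hqb
      linarith

/-! ### The Frobenius norm -/

lemma frob_sq (M : Matrix (Fin d) (Fin d) ℝ) : frob M ^ 2 = ∑ i, ∑ j, M i j ^ 2 := by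
  have h : Matrix.trace (M.transpose * M) = ∑ i, ∑ j, M i j ^ 2 := by
    rw [Finset.sum_comm]
    simp [Matrix.trace, Matrix.mul_apply, pow_two]
  rw [frob, h]
  exact Real.sq_sqrt (Finset.sum_nonneg fun _ _ => Finset.sum_nonneg fun _ _ => sq_nonneg _)

lemma frob_nonneg (M : Matrix (Fin d) (Fin d) ℝ) : 0 ≤ frob M := Real.sqrt_nonneg _

lemma abs_entry_le_frob (M : Matrix (Fin d) (Fin d) ℝ) (i j : Fin d) : |M i j| ≤ frob M := by
  apply abs_le_of_sq_le_sq _ (frob_nonneg M)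
  rw [frob_sq]
  calc M i j ^ 2 ≤ ∑ j, M i j ^ 2 :=
        Finset.single_le_sum (f := fun j => M i j ^ 2) (fun _ _ => sq_nonneg _) (Finset.mem_univ j)
    _ ≤ _ := Finset.single_le_sum (f := fun i => ∑ j, M i j ^ 2)
        (fun _ _ => Finset.sum_nonneg fun _ _ => sq_nonneg _) (Finset.mem_univ i)

lemma continuous_frob : Continuous (frob : Matrix (Fin d) (Fin d) ℝ → ℝ) := by
  unfold frob
  fun_prop

lemma continuous_quad (θ : Vec d) :
    Continuous (fun M : Matrix (Fin d) (Fin d) ℝ => quad M θ) := by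
  unfold quad
  have : ∀ i j, Continuous (fun M : Matrix (Fin d) (Fin d) ℝ => M i j) :=
    fun i j => continuous_id.matrix_elem i j
  fun_prop

lemma abs_bilin_le (M : Matrix (Fin d) (Fin d) ℝ) (x y : Vec d) :
    |∑ i, ∑ j, x i * M i j * y j| ≤ frob M * (‖x‖ * ‖y‖) := by
  apply abs_le_of_sq_le_sq _ (by have := frob_nonneg M; positivity)
  rw [mul_pow, mul_pow, frob_sq, EuclideanSpace.real_norm_sq_eq, EuclideanSpace.real_norm_sq_eq]
  have h := Finset.sum_mul_sq_le_sq_mul_sq (Finset.univ : Finset (Fin d × Fin d))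
    (fun p => M p.1 p.2) (fun p => x p.1 * y p.2)
  rw [Fintype.sum_prod_type, Fintype.sum_prod_type, Fintype.sum_prod_type] at h
  calc (∑ i, ∑ j, x i * M i j * y j) ^ 2 = (∑ i, ∑ j, M i j * (x i * y j)) ^ 2 := by
        congr 1
        refine Finset.sum_congr rfl fun i _ => Finset.sum_congr rfl fun j _ => by ring
    _ ≤ _ := h
    _ = _ := by
        simp only [mul_pow, ← Finset.mul_sum, ← Finset.sum_mul]

lemma abs_quad_sub_quad_le {M : Matrix (Fin d) (Fin d) ℝ} (hM : M.IsSymm) {θ θ' : Vec d} {δ : ℝ}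
    (hθ : ‖θ‖ = 1) (hθ' : ‖θ'‖ = 1) (h : ‖θ - θ'‖ ≤ δ) :
    |quad M θ - quad M θ'| ≤ 2 * δ * frob M := by
  have hswap : ∑ i, ∑ j, θ' i * M i j * θ j = ∑ i, ∑ j, θ i * M i j * θ' j := by
    rw [Finset.sum_comm]
    refine Finset.sum_congr rfl fun i _ => Finset.sum_congr rfl fun j _ => ?_
    rw [hM.apply i j]; ring
  -- Polarization by symmetry; ‖θ + θ'‖ ≤ 2 then gives the factor 2δ.
  have e : quad M θ - quad M θ' = ∑ i, ∑ j, (θ - θ') i * M i j * (θ + θ') j := by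
    have : ∀ i j, (θ - θ') i * M i j * (θ + θ') j = θ i * M i j * θ j + θ i * M i j * θ' j
        - θ' i * M i j * θ j - θ' i * M i j * θ' j := by
      intro i j; simp; ring
    simp only [this, Finset.sum_sub_distrib, Finset.sum_add_distrib, hswap, quad]
    ring
  have hδ : 0 ≤ δ := (norm_nonneg _).trans h
  have h2 : ‖θ + θ'‖ ≤ 2 := by
    calc _ ≤ ‖θ‖ + ‖θ'‖ := norm_add_le _ _
      _ = 2 := by rw [hθ, hθ']; norm_num
  rw [e]
  calc _ ≤ frob M * (‖θ - θ'‖ * ‖θ + θ'‖) := abs_bilin_le M _ _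
    _ ≤ frob M * (δ * 2) := by
        have := frob_nonneg M
        gcongr
    _ = _ := by ring

/-! ### The convex program -/

lemma isClosed_confRegion (κ s a ε : ℝ) (x : Fin n → Vec d) (θ : Vec d) :
    IsClosed (confRegion κ s a ε x θ) := by
  have : confRegion κ s a ε x θ = Set.Ici 0 ∩ ⋂ (j : ℤ) (_ : 1 ≤ j) (_ : j ≤ gridSize n κ a)
      (α : ℝ) (_ : 0 < α), {v | |crit (lamGrid n κ a ε j) x (α • θ)
        - (α ^ 2 * v - lamGrid n κ a ε j)|
      ≤ dev n κ s a ε (lamGrid n κ a ε j) (betaGrid n κ s a j) α v} := by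
    ext v
    simp [confRegion]
  rw [this]
  refine isClosed_Ici.inter ?_
  refine isClosed_iInter fun j => isClosed_iInter fun _ => isClosed_iInter fun _ =>
    isClosed_iInter fun α => isClosed_iInter fun _ => isClosed_le (by fun_prop) ?_
  unfold dev
  fun_prop

lemma isClosed_admissible (κ s a ε : ℝ) (Θ : Finset (Vec d)) (x : Fin n → Vec d) :
    IsClosed (admissible κ s a ε Θ x) := by
  have : admissible κ s a ε Θ x = {Q | Q.transpose = Q} ∩
      ⋂ θ ∈ Θ, (fun Q => quad Q θ) ⁻¹' confRegion κ s a ε x θ := by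
    ext Q
    simp [admissible, Matrix.IsSymm]
  rw [this]
  refine (isClosed_eq (by fun_prop) continuous_id).inter ?_
  exact isClosed_biInter fun θ _ => (isClosed_confRegion κ s a ε x θ).preimage (continuous_quad θ)

/-- The admissible set is closed, and a Frobenius sublevel set has bounded entries, so the minimum
is taken over a compact set. -/
lemma exists_isSolution {κ s a ε : ℝ} {Θ : Finset (Vec d)} {x : Fin n → Vec d}
    (h : (admissible κ s a ε Θ x).Nonempty) : ∃ Q, IsSolution κ s a ε Θ x Q := by
  obtain ⟨M, hM⟩ := h
  let S := admissible κ s a ε Θ x ∩ {Q | frob Q ≤ frob M}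
  have hcube : IsCompact (Set.pi Set.univ fun _ : Fin d => Set.pi Set.univ fun _ : Fin d =>
      Set.Icc (-(frob M)) (frob M)) :=
    isCompact_univ_pi fun _ => isCompact_univ_pi fun _ => isCompact_Icc
  have hS : IsCompact S := by
    refine IsCompact.of_isClosed_subset (s := (Set.pi Set.univ fun _ : Fin d =>
      Set.pi Set.univ fun _ : Fin d => Set.Icc (-(frob M)) (frob M) :
        Set (Matrix (Fin d) (Fin d) ℝ))) hcube
      ((isClosed_admissible κ s a ε Θ x).inter (isClosed_le continuous_frob continuous_const)) ?_
    intro Q hQ i _ j _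
    exact abs_le.1 ((abs_entry_le_frob Q i j).trans hQ.2)
  obtain ⟨Q, hQ, hmin⟩ := hS.exists_isMinOn ⟨M, hM, le_refl (frob M)⟩ continuous_frob.continuousOn
  refine ⟨Q, hQ.1, fun Q' hQ' => ?_⟩
  by_cases hc : frob Q' ≤ frob M
  · exact hmin ⟨hQ', hc⟩
  · exact hQ.2.trans (not_le.1 hc).le

/-! ### A semiconcave majorant of the truncation function -/

/-- Convexity on an interval in the form of supporting lines, by the mean value theorem. -/
lemma tangent_le_of_monotoneOn {g g' : ℝ → ℝ} {S : Set ℝ} (hS : S.OrdConnected)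
    (hg : ∀ y, HasDerivAt g (g' y) y) (hmono : MonotoneOn g' S) {m y : ℝ} (hm : m ∈ S)
    (hy : y ∈ S) : g m + g' m * (y - m) ≤ g y := by
  rcases lt_trichotomy m y with h | h | h
  · obtain ⟨c, hc, he⟩ := exists_hasDerivAt_eq_slope g g' h
      (fun x _ => (hg x).continuousAt.continuousWithinAt) (fun x _ => hg x)
    have : g' m ≤ g' c := hmono hm (hS.out hm hy ⟨hc.1.le, hc.2.le⟩) hc.1.le
    rw [he, le_div_iff₀ (by linarith)] at this
    linarith
  · simp [h]
  · obtain ⟨c, hc, he⟩ := exists_hasDerivAt_eq_slope g g' h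
      (fun x _ => (hg x).continuousAt.continuousWithinAt) (fun x _ => hg x)
    have : g' c ≤ g' m := hmono (hS.out hy hm ⟨hc.1.le, hc.2.le⟩) hm hc.2.le
    rw [he, div_le_iff₀ (by linarith)] at this
    linarith

/-- The logarithm of the second order Taylor polynomial of the exponential. -/
def logTaylor (y : ℝ) : ℝ := Real.log (1 + y + y ^ 2 / 2)

lemma taylor_pos (y : ℝ) : 0 < 1 + y + y ^ 2 / 2 := by nlinarith [sq_nonneg (y + 1)]

lemma hasDerivAt_logTaylor (y : ℝ) :
    HasDerivAt logTaylor ((1 + y) / (1 + y + y ^ 2 / 2)) y := by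
  have h : HasDerivAt (fun y : ℝ => 1 + y + y ^ 2 / 2) (1 + y) y := by
    have := ((hasDerivAt_id' y).const_add 1).fun_add (((hasDerivAt_id' y).fun_pow 2).div_const 2)
    exact this.congr_deriv (by norm_num; try ring)
  exact h.log (taylor_pos y).ne'

/-- The second derivative is at least -1/4: adding y²/8 makes the function convex, as a sum of
squares in the difference of derivatives shows. -/
lemma logTaylor_tangent (m y : ℝ) :
    logTaylor m + (1 + m) / (1 + m + m ^ 2 / 2) * (y - m) - (y - m) ^ 2 / 8 ≤ logTaylor y := by
  have hd : ∀ y, HasDerivAt (fun y => logTaylor y + y ^ 2 / 8)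
      ((1 + y) / (1 + y + y ^ 2 / 2) + y / 4) y := by
    intro y
    have := (hasDerivAt_logTaylor y).fun_add (((hasDerivAt_id' y).fun_pow 2).div_const 8)
    exact this.congr_deriv (by norm_num; try ring)
  have hmono : MonotoneOn (fun y : ℝ => (1 + y) / (1 + y + y ^ 2 / 2) + y / 4) Set.univ := by
    intro x _ y _ hxy
    have hx := taylor_pos x
    have hy := taylor_pos y
    have e : (1 + y) / (1 + y + y ^ 2 / 2) + y / 4 - ((1 + x) / (1 + x + x ^ 2 / 2) + x / 4)
        = (y - x) * ((x - y) ^ 2 + ((1 + x) * (1 + y) - 3) ^ 2)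
          / (16 * ((1 + y + y ^ 2 / 2) * (1 + x + x ^ 2 / 2))) := by
      rw [div_add_div _ _ hy.ne' (by norm_num), div_add_div _ _ hx.ne' (by norm_num),
        div_sub_div _ _ (by positivity) (by positivity), div_eq_div_iff (by positivity)
        (by positivity)]
      ring
    have : 0 ≤ (y - x) * ((x - y) ^ 2 + ((1 + x) * (1 + y) - 3) ^ 2)
          / (16 * ((1 + y + y ^ 2 / 2) * (1 + x + x ^ 2 / 2))) := by
      have : 0 ≤ y - x := by linarith
      positivity
    dsimp only
    linarith
  have := tangent_le_of_monotoneOn Set.ordConnected_univ hd hmono (Set.mem_univ m) (Set.mem_univ y)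
  linarith

/-- The truncation function on `[0, 1]`. -/
def psiMid (y : ℝ) : ℝ := -Real.log (1 - y + y ^ 2 / 2)

/-- The derivative of `psiMid`. -/
def psiMidDeriv (y : ℝ) : ℝ := (1 - y) / (1 - y + y ^ 2 / 2)

lemma hasDerivAt_psiMid (y : ℝ) : HasDerivAt psiMid (psiMidDeriv y) y := by
  have h := ((hasDerivAt_logTaylor (-y)).scomp y (hasDerivAt_neg y)).neg
  have e : psiMid = -(logTaylor ∘ fun y => -y) := by
    ext y; simp [psiMid, logTaylor, sub_eq_add_neg]
  rw [e]
  convert! h using 1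
  simp [psiMidDeriv, sub_eq_add_neg]

lemma hasDerivAt_psiMid_add_sq (y : ℝ) :
    HasDerivAt (fun y => psiMid y + y ^ 2 / 8) (psiMidDeriv y + y / 4) y := by
  have := (hasDerivAt_psiMid y).fun_add (((hasDerivAt_id' y).fun_pow 2).div_const 8)
  exact this.congr_deriv (by norm_num; try ring)

/-- For x = y and w = (1-y)², the second factor of the numerator is (1+w)² - 8(1-w) = w² + 10w - 7.
Its positive root 4√2 - 5 defines `knot`. -/
lemma psiMidDeriv_add_sub (x y : ℝ) :
    psiMidDeriv y + y / 4 - (psiMidDeriv x + x / 4)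
      = (y - x) * ((1 + (1 - x) ^ 2) * (1 + (1 - y) ^ 2) - 8 * (1 - (1 - x) * (1 - y)))
        / (16 * ((1 - y + y ^ 2 / 2) * (1 - x + x ^ 2 / 2))) := by
  have hx := truncation_arg_pos x
  have hy := truncation_arg_pos y
  unfold psiMidDeriv
  rw [div_add_div _ _ hy.ne' (by norm_num), div_add_div _ _ hx.ne' (by norm_num),
    div_sub_div _ _ (by positivity) (by positivity), div_eq_div_iff (by positivity)
    (by positivity)]
  ring

/-- The product (1 + y + y²/2)(1 - y + y²/2) equals 1 + y⁴/4. -/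
lemma psiMid_le_logTaylor {y : ℝ} : psiMid y ≤ logTaylor y := by
  unfold psiMid logTaylor
  rw [neg_le_iff_add_nonneg, ← Real.log_mul (taylor_pos y).ne' (truncation_arg_pos y).ne']
  apply Real.log_nonneg
  nlinarith [sq_nonneg (y ^ 2)]

/-- The point of `[0, 1]` at which the second derivative of the truncation function is `-1/4`. -/
def knot : ℝ := 1 - Real.sqrt (4 * Real.sqrt 2 - 5)

lemma sqrt_two_bounds : 1.414 < Real.sqrt 2 ∧ Real.sqrt 2 < 1.415 := by
  constructor
  · rw [Real.lt_sqrt (by norm_num)]; norm_num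
  · rw [Real.sqrt_lt' (by norm_num)]; norm_num

lemma one_sub_knot_sq : (1 - knot) ^ 2 = 4 * Real.sqrt 2 - 5 := by
  have := sqrt_two_bounds.1
  rw [knot, sub_sub_cancel, Real.sq_sqrt (by linarith)]

lemma knot_bounds : 0 < knot ∧ knot < 1 := by
  have h := sqrt_two_bounds
  unfold knot
  constructor
  · have : Real.sqrt (4 * Real.sqrt 2 - 5) < 1 := by
      rw [Real.sqrt_lt' (by norm_num)]; linarith
    linarith
  · have : 0 < Real.sqrt (4 * Real.sqrt 2 - 5) := Real.sqrt_pos.2 (by linarith)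
    linarith

lemma psiMidDeriv_knot_sq : psiMidDeriv knot ^ 2 = (1 + 2 * Real.sqrt 2) / 4 := by
  have h := one_sub_knot_sq
  have e : 1 - knot + knot ^ 2 / 2 = 2 * (Real.sqrt 2 - 1) := by nlinarith
  have h2 : Real.sqrt 2 ^ 2 = 2 := Real.sq_sqrt (by norm_num)
  have h3 := sqrt_two_bounds.1
  have h5 : 0 < √2 - 1 := by linarith
  rw [psiMidDeriv, e, div_pow, h, div_eq_div_iff (by positivity) (by norm_num)]
  have h4 : Real.sqrt 2 ^ 3 = 2 * Real.sqrt 2 := by rw [pow_succ, h2]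
  ring_nf
  rw [h4, h2]
  ring

lemma psiMidDeriv_knot_ge : 1 / 4 ≤ psiMidDeriv knot := by
  have h0 : 0 ≤ psiMidDeriv knot :=
    div_nonneg (by linarith [knot_bounds.2]) (truncation_arg_pos _).le
  have h := psiMidDeriv_knot_sq
  have := sqrt_two_bounds.1
  nlinarith

/-- The logarithm of the cap of the majorant. -/
def logCap : ℝ := (1 + 2 * Real.sqrt 2) / 2 - Real.log (2 * (Real.sqrt 2 - 1))

/-- The left side is the maximum of the parabola of curvature -1/4 tangent to ψ at `knot`, reached
at distance 4ψ'(`knot`). The exponential in c comes from here. -/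
lemma psiMid_knot_add : psiMid knot + 2 * psiMidDeriv knot ^ 2 = logCap := by
  have h := one_sub_knot_sq
  have e : 1 - knot + knot ^ 2 / 2 = 2 * (Real.sqrt 2 - 1) := by nlinarith
  rw [psiMidDeriv_knot_sq, psiMid, e, logCap]
  ring

lemma two_le_logCap : 2 ≤ logCap := by
  have h := sqrt_two_bounds
  have := Real.log_le_sub_one_of_pos (x := 2 * (Real.sqrt 2 - 1)) (by linarith)
  unfold logCap
  linarith

lemma log_two_le_logCap : Real.log 2 ≤ logCap := by
  have := Real.log_two_lt_d9
  have := two_le_logCap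
  linarith

lemma psiMidDeriv_add_monotoneOn :
    MonotoneOn (fun y => psiMidDeriv y + y / 4) (Set.Icc 0 knot) := by
  intro x hx y hy hxy
  have e := psiMidDeriv_add_sub x y
  have hk := one_sub_knot_sq
  have hk1 := knot_bounds
  have h2 : Real.sqrt 2 ^ 2 = 2 := Real.sq_sqrt (by norm_num)
  have hw1 : (1 - knot) * (1 - knot) ≤ (1 - x) * (1 - y) :=
    mul_le_mul (by linarith [hx.2]) (by linarith [hy.2]) (by linarith) (by linarith [hx.2])
  have hx2 : (1 - knot) ^ 2 ≤ (1 - x) ^ 2 :=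
    pow_le_pow_left₀ (by linarith) (by linarith [hx.2]) 2
  have hy2 : (1 - knot) ^ 2 ≤ (1 - y) ^ 2 :=
    pow_le_pow_left₀ (by linarith) (by linarith [hy.2]) 2
  have hmul : (1 + (1 - knot) ^ 2) * (1 + (1 - knot) ^ 2)
      ≤ (1 + (1 - x) ^ 2) * (1 + (1 - y) ^ 2) :=
    mul_le_mul (by linarith) (by linarith) (by positivity) (by positivity)
  have : 0 ≤ (y - x) * ((1 + (1 - x) ^ 2) * (1 + (1 - y) ^ 2) - 8 * (1 - (1 - x) * (1 - y)))
        / (16 * ((1 - y + y ^ 2 / 2) * (1 - x + x ^ 2 / 2))) := by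
    have := truncation_arg_pos x
    have := truncation_arg_pos y
    apply div_nonneg _ (by positivity)
    apply mul_nonneg (by linarith)
    rw [hk] at hmul
    rw [← pow_two, hk] at hw1
    nlinarith
  dsimp only
  linarith

lemma psiMidDeriv_add_antitoneOn :
    AntitoneOn (fun y => psiMidDeriv y + y / 4) (Set.Icc knot 1) := by
  intro x hx y hy hxy
  have e := psiMidDeriv_add_sub x y
  have hk := one_sub_knot_sq
  have hk1 := knot_bounds
  have h2 : Real.sqrt 2 ^ 2 = 2 := Real.sq_sqrt (by norm_num)
  have hw1 : (1 - x) * (1 - y) ≤ (1 - knot) * (1 - knot) :=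
    mul_le_mul (by linarith [hx.1]) (by linarith [hy.1]) (by linarith [hy.2]) (by linarith)
  have hx2 : (1 - x) ^ 2 ≤ (1 - knot) ^ 2 :=
    pow_le_pow_left₀ (by linarith [hx.2]) (by linarith [hx.1]) 2
  have hy2 : (1 - y) ^ 2 ≤ (1 - knot) ^ 2 :=
    pow_le_pow_left₀ (by linarith [hy.2]) (by linarith [hy.1]) 2
  have hmul : (1 + (1 - x) ^ 2) * (1 + (1 - y) ^ 2)
      ≤ (1 + (1 - knot) ^ 2) * (1 + (1 - knot) ^ 2) :=
    mul_le_mul (by linarith) (by linarith) (by positivity) (by positivity)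
  have : 0 ≤ (y - x) * (8 * (1 - (1 - x) * (1 - y)) - (1 + (1 - x) ^ 2) * (1 + (1 - y) ^ 2))
        / (16 * ((1 - y + y ^ 2 / 2) * (1 - x + x ^ 2 / 2))) := by
    have := truncation_arg_pos x
    have := truncation_arg_pos y
    apply div_nonneg _ (by positivity)
    apply mul_nonneg (by linarith)
    rw [hk] at hmul
    rw [← pow_two, hk] at hw1
    nlinarith
  have e2 : (y - x) * ((1 + (1 - x) ^ 2) * (1 + (1 - y) ^ 2) - 8 * (1 - (1 - x) * (1 - y)))
        / (16 * ((1 - y + y ^ 2 / 2) * (1 - x + x ^ 2 / 2)))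
      = -((y - x) * (8 * (1 - (1 - x) * (1 - y)) - (1 + (1 - x) ^ 2) * (1 + (1 - y) ^ 2))
        / (16 * ((1 - y + y ^ 2 / 2) * (1 - x + x ^ 2 / 2)))) := by ring
  dsimp only
  linarith

/-- The bounded function by which the truncation function is dominated after averaging. -/
def chi (y : ℝ) : ℝ := min (logTaylor y) logCap

lemma chi_knot_bound (y : ℝ) :
    psiMid knot + psiMidDeriv knot * (y - knot) - (y - knot) ^ 2 / 8 ≤ logCap := by
  rw [← psiMid_knot_add]
  nlinarith [sq_nonneg (psiMidDeriv knot * 4 - (y - knot))]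

lemma psiMid_tangent {m y : ℝ} (hm : m ∈ Set.Icc 0 knot) (hy : y ∈ Set.Icc 0 knot) :
    psiMid m + psiMidDeriv m * (y - m) - (y - m) ^ 2 / 8 ≤ psiMid y := by
  have := tangent_le_of_monotoneOn Set.ordConnected_Icc hasDerivAt_psiMid_add_sq
    psiMidDeriv_add_monotoneOn hm hy
  linarith

/-- Since ψ' + y/4 increases on [0, `knot`], the parabola at m stays below the one at 0 for y ≤ 0,
below ψ on [0, `knot`], and below the one at `knot` afterwards; each of these lies below χ. -/
lemma chi_of_mem_Icc {m : ℝ} (hm : m ∈ Set.Icc 0 knot) (y : ℝ) :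
    psiMid m + psiMidDeriv m * (y - m) - (y - m) ^ 2 / 8 ≤ chi y := by
  have hk := knot_bounds
  have h0 : (0 : ℝ) ∈ Set.Icc 0 knot := ⟨le_rfl, hk.1.le⟩
  have h1 : knot ∈ Set.Icc 0 knot := ⟨hk.1.le, le_rfl⟩
  have hcap : psiMid knot ≤ logCap := by
    rw [← psiMid_knot_add]; nlinarith [sq_nonneg (psiMidDeriv knot)]
  have t0 := psiMid_tangent hm h0
  have t1 := psiMid_tangent hm h1
  have d0 : psiMidDeriv 0 + 0 / 4 ≤ psiMidDeriv m + m / 4 :=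
    psiMidDeriv_add_monotoneOn h0 hm hm.1
  have d1 : psiMidDeriv m + m / 4 ≤ psiMidDeriv knot + knot / 4 :=
    psiMidDeriv_add_monotoneOn hm h1 hm.2
  have e0 : psiMidDeriv 0 = 1 := by simp [psiMidDeriv]
  have e0' : psiMid 0 = 0 := by simp [psiMid]
  rw [chi, le_min_iff]
  rcases le_total y 0 with hy | hy
  · have hb : psiMid m + psiMidDeriv m * (y - m) - (y - m) ^ 2 / 8 ≤ y - y ^ 2 / 8 := by
      have := mul_nonneg_of_nonpos_of_nonpos hy
        (show 1 - (psiMidDeriv m + m / 4) ≤ 0 by linarith)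
      nlinarith
    have hl := logTaylor_tangent 0 y
    simp [logTaylor] at hl
    refine ⟨hb.trans (by simpa [logTaylor] using hl), ?_⟩
    have := two_le_logCap
    nlinarith [sq_nonneg y]
  rcases le_total y knot with hyk | hyk
  · have hb := psiMid_tangent hm ⟨hy, hyk⟩
    refine ⟨hb.trans psiMid_le_logTaylor, hb.trans (le_trans ?_ hcap)⟩
    unfold psiMid
    apply neg_le_neg
    apply Real.log_le_log (truncation_arg_pos _)
    nlinarith
  · have hb : psiMid m + psiMidDeriv m * (y - m) - (y - m) ^ 2 / 8
        ≤ psiMid knot + psiMidDeriv knot * (y - knot) - (y - knot) ^ 2 / 8 := by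
      have := mul_nonneg (sub_nonneg.2 hyk) (sub_nonneg.2 d1)
      nlinarith
    refine ⟨hb.trans ?_, hb.trans (chi_knot_bound y)⟩
    have hl := logTaylor_tangent knot y
    have hd : psiMidDeriv knot ≤ (1 + knot) / (1 + knot + knot ^ 2 / 2) := by
      unfold psiMidDeriv
      rw [div_le_div_iff₀ (truncation_arg_pos _) (taylor_pos _)]
      have : 0 < knot ^ 3 := pow_pos hk.1 3
      nlinarith
    have := psiMid_le_logTaylor (y := knot)
    have := mul_le_mul_of_nonneg_right hd (sub_nonneg.2 hyk)
    linarith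

lemma psi_of_mem_Icc {m : ℝ} (h0 : 0 ≤ m) (h1 : m ≤ 1) : psi m = psiMid m := by
  rw [psi, if_pos h0, min_eq_left h1, psiMid]

lemma psi_of_one_le {m : ℝ} (h1 : 1 ≤ m) : psi m = Real.log 2 := by
  rw [psi, if_pos (by linarith), min_eq_right h1, ← Real.log_inv]
  norm_num

lemma psi_neg (m : ℝ) : psi (-m) = -psi m := by
  unfold psi
  rcases lt_trichotomy m 0 with h | h | h
  · rw [if_pos (by linarith), if_neg (by linarith)]
  · simp [h]
  · rw [if_neg (by linarith), if_pos h.le, neg_neg, neg_neg]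

lemma abs_psi_le (m : ℝ) : |psi m| ≤ Real.log 2 := by
  have key : ∀ t, psi t ≤ Real.log 2 := by
    intro t
    rw [← psi_of_one_le (le_max_right t 1)]
    exact psi_mono (le_max_left _ _)
  rw [abs_le]
  refine ⟨?_, key m⟩
  have := key (-m)
  rw [psi_neg] at this
  linarith

/-- Between `knot` and 1, ψ is more concave than the parabola; after 1 it is constant, while the
parabola increases up to its vertex. -/
lemma psi_le_knot_parabola {m : ℝ} (hm : knot ≤ m) (hm' : m ≤ knot + 4 * psiMidDeriv knot) :
    psi m ≤ psiMid knot + psiMidDeriv knot * (m - knot) - (m - knot) ^ 2 / 8 := by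
  have hk := knot_bounds
  have key : ∀ y ∈ Set.Icc knot 1,
      psiMid y ≤ psiMid knot + psiMidDeriv knot * (y - knot) - (y - knot) ^ 2 / 8 := by
    intro y hy
    have := tangent_le_of_monotoneOn (g := fun y => -(psiMid y + y ^ 2 / 8))
      (g' := fun y => -(psiMidDeriv y + y / 4)) (Set.ordConnected_Icc (a := knot) (b := 1))
      (fun y => (hasDerivAt_psiMid_add_sq y).neg)
      (fun x hx y hy h => neg_le_neg (psiMidDeriv_add_antitoneOn hx hy h))
      ⟨le_rfl, hk.2.le⟩ hy
    linarith
  rcases le_total m 1 with h | h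
  · rw [psi_of_mem_Icc (hk.1.le.trans hm) h]
    exact key m ⟨hm, h⟩
  · have h1 := key 1 ⟨hk.2.le, le_rfl⟩
    rw [← psi_of_mem_Icc zero_le_one le_rfl, psi_of_one_le le_rfl] at h1
    rw [psi_of_one_le h]
    have : 0 ≤ (m - 1) * (psiMidDeriv knot - ((m - knot) + (1 - knot)) / 8) :=
      mul_nonneg (by linarith) (by linarith)
    nlinarith

/-- For m ≤ -1, ψ is the minimum of `logTaylor` and s = 0. On [-1, `knot`] the slope is that of ψ;
from there to the vertex it is that of the parabola at `knot`; beyond the vertex s = 0. -/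
lemma exists_chi_tangent (m : ℝ) :
    ∃ s : ℝ, ∀ y, psi m + s * (y - m) - (y - m) ^ 2 / 8 ≤ chi y := by
  have hk := knot_bounds
  have hp := psiMidDeriv_knot_ge
  have h2 := log_two_le_logCap
  have hl2 : 0 < Real.log 2 := Real.log_pos (by norm_num)
  rcases le_total m (-1) with h | h
  · refine ⟨0, fun y => ?_⟩
    have e : psi m = -Real.log 2 := by
      rw [← neg_neg m, psi_neg, psi_of_one_le (by linarith)]
    have : -Real.log 2 ≤ logTaylor y := by
      rw [logTaylor, ← Real.log_inv]
      apply Real.log_le_log (by norm_num)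
      nlinarith [sq_nonneg (y + 1)]
    rw [e, chi, le_min_iff]
    constructor <;> nlinarith [sq_nonneg (y - m)]
  rcases le_total m 0 with h' | h'
  · refine ⟨(1 + m) / (1 + m + m ^ 2 / 2), fun y => ?_⟩
    have e : psi m = logTaylor m := by
      rw [← neg_neg m, psi_neg, psi_of_mem_Icc (by linarith) (by linarith), psiMid, logTaylor,
        neg_neg]
      ring_nf
    rw [e, chi, le_min_iff]
    refine ⟨logTaylor_tangent m y, ?_⟩
    have hs : (1 + m) / (1 + m + m ^ 2 / 2) ≤ 1 := by
      rw [div_le_one (taylor_pos m)]; nlinarith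
    have hs0 : 0 ≤ (1 + m) / (1 + m + m ^ 2 / 2) :=
      div_nonneg (by linarith) (taylor_pos m).le
    have hm0 : logTaylor m ≤ 0 := Real.log_nonpos (taylor_pos m).le (by nlinarith)
    have := two_le_logCap
    set q := (1 + m) / (1 + m + m ^ 2 / 2)
    nlinarith [sq_nonneg (4 * q - (y - m))]
  rcases le_total m knot with h1 | h1
  · refine ⟨psiMidDeriv m, fun y => ?_⟩
    rw [psi_of_mem_Icc h' (by linarith)]
    exact chi_of_mem_Icc ⟨h', h1⟩ y
  have hL := chi_of_mem_Icc (m := knot) ⟨hk.1.le, le_rfl⟩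
  rcases le_total m (knot + 4 * psiMidDeriv knot) with h3 | h3
  · refine ⟨psiMidDeriv knot - (m - knot) / 4, fun y => ?_⟩
    refine le_trans ?_ (hL y)
    have := psi_le_knot_parabola h1 h3
    nlinarith
  · refine ⟨0, fun y => ?_⟩
    rw [psi_of_one_le (by linarith)]
    rcases le_total y (knot + 4 * psiMidDeriv knot) with hy | hy
    · refine le_trans ?_ (hL y)
      have e := psiMid_knot_add
      have : (knot + 4 * psiMidDeriv knot - y) ^ 2 ≤ (m - y) ^ 2 := by
        apply pow_le_pow_left₀ <;> linarith
      nlinarith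
    · have : Real.log 2 ≤ logTaylor y := by
        apply Real.log_le_log (by norm_num)
        nlinarith
      rw [chi, le_min_iff]
      constructor <;> nlinarith [sq_nonneg (y - m)]

lemma chi_bounds (y : ℝ) : -Real.log 2 ≤ chi y ∧ chi y ≤ logCap := by
  refine ⟨le_min ?_ ?_, min_le_right _ _⟩
  · rw [logTaylor, ← Real.log_inv]
    apply Real.log_le_log (by norm_num)
    nlinarith [sq_nonneg (y + 1)]
  · have h2 := log_two_le_logCap
    have hl2 : 0 < Real.log 2 := Real.log_pos (by norm_num)
    linarith

lemma measurable_chi : Measurable chi := by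
  unfold chi logTaylor
  fun_prop

/-- Integrating the parabola at the mean kills its linear term and leaves the variance. The cap log
4 is the gap between ψ ≤ log 2 and χ ≥ -log 2. -/
lemma psi_integral_le {Ω : Type*} [MeasurableSpace Ω] {ν : Measure Ω} [IsProbabilityMeasure ν]
    {h : Ω → ℝ} {m : ℝ} (hh : MemLp h 2 ν) (hm : ∫ ω, h ω ∂ν = m) :
    psi m ≤ ∫ ω, chi (h ω) ∂ν + min (Real.log 4) ((∫ ω, (h ω - m) ^ 2 ∂ν) / 8) := by
  have hint : Integrable h ν := hh.integrable (by norm_num)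
  have hsq : Integrable (fun ω => (h ω - m) ^ 2) ν := (hh.sub (memLp_const m)).integrable_sq
  have hchi : Integrable (fun ω => chi (h ω)) ν := by
    refine Integrable.of_bound (C := max (Real.log 2) logCap)
      (measurable_chi.comp_aemeasurable hint.aemeasurable).aestronglyMeasurable ?_
    refine Filter.Eventually.of_forall fun ω => ?_
    have := chi_bounds (h ω)
    rw [Real.norm_eq_abs, abs_le]
    constructor
    · linarith [le_max_left (Real.log 2) logCap]
    · exact this.2.trans (le_max_right _ _)
  rw [← sub_le_iff_le_add', le_min_iff]
  constructor
  · have h1 : -Real.log 2 ≤ ∫ ω, chi (h ω) ∂ν := by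
      calc -Real.log 2 = ∫ ω, -Real.log 2 ∂ν := by simp
        _ ≤ _ := integral_mono (integrable_const _) hchi fun ω => (chi_bounds _).1
    have h2 := (abs_le.1 (abs_psi_le m)).2
    have h4 : Real.log 4 = 2 * Real.log 2 := by
      rw [show (4 : ℝ) = 2 ^ 2 by norm_num, Real.log_pow]; norm_num
    linarith
  · obtain ⟨s, hs⟩ := exists_chi_tangent m
    have h1 : Integrable (fun ω => s * (h ω - m)) ν :=
      (hint.sub (integrable_const m)).const_mul s
    have h0 : Integrable (fun ω => psi m + s * (h ω - m)) ν := (integrable_const _).add h1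
    have h2 : ∫ ω, (psi m + s * (h ω - m) - (h ω - m) ^ 2 / 8) ∂ν ≤ ∫ ω, chi (h ω) ∂ν :=
      integral_mono (h0.sub (hsq.div_const 8)) hchi fun ω => hs (h ω)
    rw [integral_sub h0 (hsq.div_const 8), integral_add (integrable_const _) h1,
      integral_const_mul, integral_sub hint (integrable_const m), hm, integral_div] at h2
    simp at h2
    linarith

/-- On [0, 4 log 2] the exponential lies below its chord, of slope 15/(4 log 2). The factor exp χ is
bounded by the quadratic in the main term and by exp `logCap` in the correction; the product of the
latter with the slope is c. -/
lemma exp_chi_add_le {R : ℝ} (hR : 0 ≤ R) (y : ℝ) :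
    Real.exp (chi y + min (4 * Real.log 2) R) ≤ 1 + y + y ^ 2 / 2 + cst * R := by
  have hl2 : 0 < Real.log 2 := Real.log_pos (by norm_num)
  have hs := sqrt_two_bounds.1
  have h1 : Real.exp (chi y) ≤ 1 + y + y ^ 2 / 2 := by
    rw [← Real.exp_log (taylor_pos y)]
    exact Real.exp_le_exp.2 (min_le_left _ _)
  have h2 : Real.exp (chi y) ≤ Real.exp logCap := Real.exp_le_exp.2 (min_le_right _ _)
  have h16 : Real.exp (4 * Real.log 2) = 16 := by
    rw [mul_comm, Real.exp_mul, Real.exp_log (by norm_num)]; norm_num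
  set u := min (4 * Real.log 2) R with hu
  have hu0 : 0 ≤ u := le_min (by positivity) hR
  have hu1 : u ≤ 4 * Real.log 2 := min_le_left _ _
  have h3 : Real.exp u ≤ 1 + 15 / (4 * Real.log 2) * u := by
    have := convexOn_exp.2 (Set.mem_univ (0 : ℝ)) (Set.mem_univ (4 * Real.log 2))
      (show 0 ≤ 1 - u / (4 * Real.log 2) by
        rw [sub_nonneg, div_le_one (by positivity)]; exact hu1)
      (show 0 ≤ u / (4 * Real.log 2) by positivity) (by ring)
    rw [smul_eq_mul, smul_eq_mul, smul_eq_mul, smul_eq_mul, h16, Real.exp_zero, mul_zero, zero_add,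
      div_mul_cancel₀ _ (by positivity)] at this
    calc _ ≤ _ := this
      _ = _ := by ring
  have hc : cst = Real.exp logCap * (15 / (4 * Real.log 2)) := by
    have : 0 < √2 - 1 := by linarith
    rw [cst, logCap, Real.exp_sub, Real.exp_log (by positivity)]
    field_simp
    norm_num
  have hcpos := cst_pos
  have h3' : 0 ≤ 15 / (4 * Real.log 2) * u := by positivity
  have hE := Real.exp_pos (chi y)
  rw [Real.exp_add]
  calc Real.exp (chi y) * Real.exp u ≤ Real.exp (chi y) * (1 + 15 / (4 * Real.log 2) * u) := by
        gcongr
    _ = Real.exp (chi y) + Real.exp (chi y) * (15 / (4 * Real.log 2) * u) := by ring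
    _ ≤ (1 + y + y ^ 2 / 2) + Real.exp logCap * (15 / (4 * Real.log 2) * u) := by gcongr
    _ = 1 + y + y ^ 2 / 2 + cst * u := by rw [hc]; ring
    _ ≤ _ := by
        have := mul_le_mul_of_nonneg_left (min_le_right (4 * Real.log 2) R) hcpos.le
        linarith

/-! ### Gaussian perturbations -/

lemma iteratedDeriv_four_gaussian_mgf (v : ℝ) :
    iteratedDeriv 4 (fun t : ℝ => Real.exp (v * t ^ 2 / 2)) 0 = 3 * v ^ 2 := by
  have h0 : ∀ t : ℝ, HasDerivAt (fun t : ℝ => Real.exp (v * t ^ 2 / 2))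
      (Real.exp (v * t ^ 2 / 2) * (v * t)) t := by
    intro t
    have := ((((hasDerivAt_id' t).fun_pow 2).const_mul v).div_const 2).exp
    exact this.congr_deriv (by norm_num; ring)
  have step : ∀ (p p' : ℝ → ℝ), (∀ t, HasDerivAt p (p' t) t) →
      deriv (fun t => Real.exp (v * t ^ 2 / 2) * p t)
        = fun t => Real.exp (v * t ^ 2 / 2) * (v * t * p t + p' t) := by
    intro p p' hp
    funext t
    rw [((h0 t).fun_mul (hp t)).deriv]
    ring
  have d1 : deriv (fun t : ℝ => Real.exp (v * t ^ 2 / 2))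
      = fun t => Real.exp (v * t ^ 2 / 2) * (v * t) := funext fun t => (h0 t).deriv
  have d2 := step (fun t => v * t) (fun _ => v) fun t => by
    simpa using (hasDerivAt_id' t).const_mul v
  have d3 := step (fun t => v * t * (v * t) + v) (fun t => 2 * v ^ 2 * t) fun t => by
    have h := (hasDerivAt_id' t).const_mul v
    exact ((h.fun_mul h).add_const v).congr_deriv (by ring)
  have d4 := step (fun t => v * t * (v * t * (v * t) + v) + 2 * v ^ 2 * t)
    (fun t => 3 * v ^ 3 * t ^ 2 + 3 * v ^ 2) fun t => by
    have h := (hasDerivAt_id' t).const_mul v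
    have h2 := (hasDerivAt_id' t).const_mul (2 * v ^ 2)
    exact ((h.fun_mul ((h.fun_mul h).add_const v)).fun_add h2).congr_deriv (by ring)
  simp only [iteratedDeriv_succ', iteratedDeriv_zero]
  rw [d1, d2, d3, d4]
  simp

lemma integral_pow_four_gaussianReal (v : NNReal) :
    ∫ t, t ^ 4 ∂(gaussianReal 0 v) = 3 * (v : ℝ) ^ 2 := by
  have h := iteratedDeriv_mgf_zero (X := id) (μ := gaussianReal 0 v)
    (by rw [integrableExpSet_id_gaussianReal]; simp) 4
  rw [mgf_id_gaussianReal] at h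
  simp only [zero_mul, zero_add, Pi.pow_apply, id] at h
  rw [← h, iteratedDeriv_four_gaussian_mgf]

lemma map_neg_stdGaussian :
    (stdGaussian (Vec d)).map (fun g => -g) = stdGaussian (Vec d) :=
  stdGaussian_map (LinearIsometryEquiv.neg ℝ)

lemma map_inner_stdGaussian (x : Vec d) :
    (stdGaussian (Vec d)).map (fun g => inner ℝ x g) = gaussianReal 0 (‖x‖ ^ 2).toNNReal := by
  have h := IsGaussian.map_eq_gaussianReal (μ := stdGaussian (Vec d)) (innerSL ℝ x)
  rw [integral_strongDual_stdGaussian, variance_dual_stdGaussian, innerSL_apply_norm] at h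
  exact h

lemma memLp_inner_stdGaussian (x : Vec d) (p : ENNReal) (hp : p ≠ ⊤) :
    MemLp (fun g => inner ℝ x g) p (stdGaussian (Vec d)) :=
  IsGaussian.memLp_dual (stdGaussian (Vec d)) (innerSL ℝ x) p hp

lemma integrable_inner_pow (x : Vec d) (k : ℕ) :
    Integrable (fun g => (inner ℝ x g) ^ k) (stdGaussian (Vec d)) := by
  rcases Nat.eq_zero_or_pos k with rfl | hk
  · simp
  have h := (memLp_inner_stdGaussian x k (by simp)).integrable_norm_pow hk.ne'
  refine h.mono' ?_ (Filter.Eventually.of_forall fun g => by simp)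
  exact Measurable.aestronglyMeasurable (by fun_prop)

lemma integral_inner_odd (x : Vec d) {k : ℕ} (hk : Odd k) :
    ∫ g, (inner ℝ x g) ^ k ∂(stdGaussian (Vec d)) = 0 := by
  have h : ∫ g, (inner ℝ x g) ^ k ∂(stdGaussian (Vec d))
      = ∫ g, -(inner ℝ x g) ^ k ∂(stdGaussian (Vec d)) := by
    conv_lhs => rw [← map_neg_stdGaussian]
    rw [integral_map (by fun_prop) (Measurable.aestronglyMeasurable (by fun_prop))]
    simp [inner_neg_right, hk.neg_pow]
  rw [integral_neg] at h
  linarith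

lemma integral_inner_sq (x : Vec d) :
    ∫ g, (inner ℝ x g) ^ 2 ∂(stdGaussian (Vec d)) = ‖x‖ ^ 2 := by
  have h1 : Var[fun g => inner ℝ x g; stdGaussian (Vec d)] = ‖x‖ ^ 2 := by
    have := variance_dual_stdGaussian (innerSL ℝ x)
    rw [innerSL_apply_norm] at this
    exact this
  have h0 := integral_inner_odd x (k := 1) (by decide)
  simp only [pow_one] at h0
  rw [variance_of_integral_eq_zero (by fun_prop) h0] at h1
  exact h1

lemma integral_inner_pow_four (x : Vec d) :
    ∫ g, (inner ℝ x g) ^ 4 ∂(stdGaussian (Vec d)) = 3 * ‖x‖ ^ 4 := by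
  have h := integral_pow_four_gaussianReal (‖x‖ ^ 2).toNNReal
  rw [← map_inner_stdGaussian, integral_map (by fun_prop)
    (Measurable.aestronglyMeasurable (by fun_prop)), Real.coe_toNNReal _ (by positivity)] at h
  rw [h]; ring

lemma integral_poly_inner (x : Vec d) (a₀ a₁ a₂ a₃ a₄ : ℝ) :
    Integrable (fun g => a₀ + a₁ * inner ℝ x g + a₂ * (inner ℝ x g) ^ 2 + a₃ * (inner ℝ x g) ^ 3
      + a₄ * (inner ℝ x g) ^ 4) (stdGaussian (Vec d)) ∧
    ∫ g, (a₀ + a₁ * inner ℝ x g + a₂ * (inner ℝ x g) ^ 2 + a₃ * (inner ℝ x g) ^ 3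
      + a₄ * (inner ℝ x g) ^ 4) ∂(stdGaussian (Vec d)) = a₀ + a₂ * ‖x‖ ^ 2 + 3 * a₄ * ‖x‖ ^ 4 := by
  have i1 : Integrable (fun g => a₁ * inner ℝ x g) (stdGaussian (Vec d)) := by
    simpa using (integrable_inner_pow x 1).const_mul a₁
  have i2 := (integrable_inner_pow x 2).const_mul a₂
  have i3 := (integrable_inner_pow x 3).const_mul a₃
  have i4 := (integrable_inner_pow x 4).const_mul a₄
  have i0 : Integrable (fun _ => a₀) (stdGaussian (Vec d)) := integrable_const _
  have h1 := integral_inner_odd x (k := 1) (by decide)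
  simp only [pow_one] at h1
  have j1 := i0.fun_add i1
  have j2 := j1.fun_add i2
  have j3 := j2.fun_add i3
  refine ⟨j3.fun_add i4, ?_⟩
  rw [integral_add j3 i4, integral_add j2 i3, integral_add j1 i2, integral_add i0 i1]
  simp only [integral_const_mul, integral_inner_odd x (k := 3) (by decide), integral_inner_sq,
    integral_inner_pow_four, h1]
  simp
  ring

lemma integral_exp_inner_stdGaussian (x : Vec d) :
    ∫ g, Real.exp (inner ℝ x g) ∂(stdGaussian (Vec d)) = Real.exp (‖x‖ ^ 2 / 2) := by
  have h := mgf_gaussianReal (map_inner_stdGaussian x) 1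
  simp only [mgf, one_mul] at h
  rw [h, Real.coe_toNNReal _ (by positivity)]
  simp

lemma integrable_exp_inner_stdGaussian (x : Vec d) :
    Integrable (fun g => Real.exp (inner ℝ x g)) (stdGaussian (Vec d)) := by
  have h := integrable_exp_mul_gaussianReal (μ := 0) (v := (‖x‖ ^ 2).toNNReal) 1
  rw [← map_inner_stdGaussian, integrable_map_measure
    (Measurable.aestronglyMeasurable (by fun_prop)) (by fun_prop)] at h
  simpa [Function.comp_def] using h

lemma stdGaussian_tilted (η : Vec d) :
    (stdGaussian (Vec d)).tilted (fun g => inner ℝ η g)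
      = (stdGaussian (Vec d)).map (fun g => g + η) := by
  have hp := isProbabilityMeasure_tilted (integrable_exp_inner_stdGaussian η)
  have hp' : IsProbabilityMeasure ((stdGaussian (Vec d)).map (fun g => g + η)) :=
    Measure.isProbabilityMeasure_map (by fun_prop)
  refine Measure.ext_of_charFun (funext fun x => ?_)
  have hmgf1 : mgf (fun g => inner ℝ g x) ((stdGaussian (Vec d)).tilted (fun g => inner ℝ η g))
      = fun t => Real.exp (t * inner ℝ η x + t ^ 2 * ‖x‖ ^ 2 / 2) := by
    funext t
    rw [mgf, integral_tilted, integral_exp_inner_stdGaussian]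
    simp only [smul_eq_mul]
    have : ∀ g : Vec d, Real.exp (inner ℝ η g) / Real.exp (‖η‖ ^ 2 / 2) * Real.exp (t * inner ℝ g x)
        = Real.exp (-(‖η‖ ^ 2 / 2)) * Real.exp (inner ℝ (η + t • x) g) := by
      intro g
      rw [← Real.exp_sub, ← Real.exp_add, ← Real.exp_add, inner_add_left, real_inner_smul_left,
        real_inner_comm x g]
      ring_nf
    simp only [this]
    rw [integral_const_mul, integral_exp_inner_stdGaussian, ← Real.exp_add, norm_add_sq_real,
      real_inner_smul_right, norm_smul, mul_pow, Real.norm_eq_abs, sq_abs]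
    ring_nf
  have hmgf2 : mgf (fun g => inner ℝ g x) ((stdGaussian (Vec d)).map (fun g => g + η))
      = fun t => Real.exp (t * inner ℝ η x + t ^ 2 * ‖x‖ ^ 2 / 2) := by
    funext t
    rw [mgf, integral_map (by fun_prop) (Measurable.aestronglyMeasurable (by fun_prop))]
    have : ∀ g : Vec d, Real.exp (t * inner ℝ (g + η) x)
        = Real.exp (t * inner ℝ η x) * Real.exp (inner ℝ (t • x) g) := by
      intro g
      rw [← Real.exp_add, inner_add_left, real_inner_smul_left, real_inner_comm x g]
      ring_nf
    simp only [this]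
    rw [integral_const_mul, integral_exp_inner_stdGaussian, ← Real.exp_add, norm_smul, mul_pow,
      Real.norm_eq_abs, sq_abs]
  have hset : integrableExpSet (fun g => inner ℝ g x)
      ((stdGaussian (Vec d)).tilted (fun g => inner ℝ η g)) = Set.univ := by
    ext t
    simp only [integrableExpSet, Set.mem_ofPred_eq, Set.mem_univ, iff_true]
    by_contra hcon
    have := congrFun hmgf1 t
    rw [mgf, integral_undef hcon] at this
    exact absurd this.symm (Real.exp_pos _).ne'
  -- Equal moment generating functions extend analytically to the imaginary axis, where they are
  -- characteristic functions.
  have key := eqOn_complexMGF_of_mgf (hmgf1.trans hmgf2.symm) (x := Complex.I)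
    (by rw [hset]; simp)
  simp only [complexMGF] at key
  simp only [charFun_apply]
  convert key using 4 <;> simp [mul_comm]

lemma lintegral_stdGaussian_translate (η : Vec d) {Φ : Vec d → ENNReal} (hΦ : Measurable Φ) :
    ∫⁻ g, Φ g ∂(stdGaussian (Vec d)) = ∫⁻ g, ENNReal.ofReal
      (Real.exp (-inner ℝ η g - ‖η‖ ^ 2 / 2)) * Φ (g + η) ∂(stdGaussian (Vec d)) := by
  have h : ∫⁻ g, Φ (g + η) ∂((stdGaussian (Vec d)).map (fun g => g + -η))
      = ∫⁻ g, Φ g ∂(stdGaussian (Vec d)) := by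
    rw [lintegral_map (by fun_prop) (by fun_prop)]
    simp
  rw [← h, ← stdGaussian_tilted, lintegral_tilted, integral_exp_inner_stdGaussian]
  refine lintegral_congr fun g => ?_
  rw [← Real.exp_sub, inner_neg_left, norm_neg]

lemma ofReal_integral_le_lintegral_ofReal {α : Type*} [MeasurableSpace α] {ν : Measure α}
    {f : α → ℝ} (hf : Integrable f ν) :
    ENNReal.ofReal (∫ a, f a ∂ν) ≤ ∫⁻ a, ENNReal.ofReal (f a) ∂ν := by
  rw [integral_eq_lintegral_pos_part_sub_lintegral_neg_part hf]
  refine (ENNReal.ofReal_le_ofReal (sub_le_self _ ENNReal.toReal_nonneg)).trans ?_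
  exact ENNReal.ofReal_toReal_le

/-- The Donsker–Varadhan inequality for a translated Gaussian measure. -/
lemma exp_integral_translate_le (η : Vec d) {h : Vec d → ℝ} (hm : Measurable h)
    (hi : Integrable (fun g => h (g + η)) (stdGaussian (Vec d))) :
    ENNReal.ofReal (Real.exp (∫ g, h (g + η) ∂(stdGaussian (Vec d)) - ‖η‖ ^ 2 / 2))
      ≤ ∫⁻ g, ENNReal.ofReal (Real.exp (h g)) ∂(stdGaussian (Vec d)) := by
  have hη : Integrable (fun g => inner ℝ η g) (stdGaussian (Vec d)) := by
    simpa using integrable_inner_pow η 1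
  have hη0 := integral_inner_odd η (k := 1) (by decide)
  simp only [pow_one] at hη0
  rw [lintegral_stdGaussian_translate η (by fun_prop)]
  set m := ∫ g, h (g + η) ∂(stdGaussian (Vec d)) - ‖η‖ ^ 2 / 2 with hmdef
  have hηc : Integrable (fun g => -inner ℝ η g - ‖η‖ ^ 2 / 2) (stdGaussian (Vec d)) :=
    hη.neg.sub (integrable_const _)
  have hu : Integrable (fun g => -inner ℝ η g - ‖η‖ ^ 2 / 2 + h (g + η)) (stdGaussian (Vec d)) :=
    hηc.add hi
  have hum : ∫ g, (-inner ℝ η g - ‖η‖ ^ 2 / 2 + h (g + η)) ∂(stdGaussian (Vec d)) = m := by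
    rw [integral_add hηc hi, integral_sub hη.fun_neg (integrable_const _), integral_neg, hη0, hmdef]
    simp
    ring
  have hum' : Integrable (fun g => (-inner ℝ η g - ‖η‖ ^ 2 / 2 + h (g + η)) - m)
      (stdGaussian (Vec d)) := hu.sub (integrable_const _)
  -- Jensen by hand: the tangent to exp at m integrates to exp m. Only the exponent has to be
  -- integrable, not its exponential.
  have hlin : Integrable (fun g => Real.exp m
      * (1 + ((-inner ℝ η g - ‖η‖ ^ 2 / 2 + h (g + η)) - m))) (stdGaussian (Vec d)) :=
    ((integrable_const _).add hum').const_mul _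
  have hlinm : ∫ g, Real.exp m * (1 + ((-inner ℝ η g - ‖η‖ ^ 2 / 2 + h (g + η)) - m))
      ∂(stdGaussian (Vec d)) = Real.exp m := by
    rw [integral_const_mul, integral_add (integrable_const _) hum',
      integral_sub hu (integrable_const _), hum]
    simp
  calc ENNReal.ofReal (Real.exp m)
      ≤ ∫⁻ g, ENNReal.ofReal (Real.exp m
        * (1 + ((-inner ℝ η g - ‖η‖ ^ 2 / 2 + h (g + η)) - m))) ∂(stdGaussian (Vec d)) := by
        conv_lhs => rw [← hlinm]
        exact ofReal_integral_le_lintegral_ofReal hlin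
    _ ≤ _ := by
        refine lintegral_mono fun g => ?_
        rw [← ENNReal.ofReal_mul (Real.exp_nonneg _), ← Real.exp_add]
        apply ENNReal.ofReal_le_ofReal
        set u := -inner ℝ η g - ‖η‖ ^ 2 / 2 + h (g + η)
        calc Real.exp m * (1 + (u - m)) ≤ Real.exp m * Real.exp (u - m) := by
              gcongr
              linarith [Real.add_one_le_exp (u - m)]
          _ = Real.exp u := by rw [← Real.exp_add]; ring_nf

/-! ### Smoothing of the truncated criterion -/

/-- The centered argument of the truncation function, up to the sign `s`. -/
def centeredArg (s lam b : ℝ) (θ x : Vec d) : ℝ :=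
  s * ((inner ℝ θ x) ^ 2 - b ^ 2 * ‖x‖ ^ 2 - lam)

/-- The variance term of the smoothed criterion. -/
def varTerm (b : ℝ) (θ x : Vec d) : ℝ :=
  b ^ 2 * ((inner ℝ θ x) ^ 2 * ‖x‖ ^ 2) + b ^ 4 * ‖x‖ ^ 4 / 2

/-- The bounded integrand to which the PAC-Bayesian inequality is applied. -/
def smoothed (s lam b : ℝ) (θ x : Vec d) : ℝ :=
  chi (centeredArg s lam b θ x) + min (4 * Real.log 2) (varTerm b θ x)

/-- A polynomial bound on the exponential moment of `smoothed`. -/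
def momentPoly (s lam b : ℝ) (θ x : Vec d) : ℝ :=
  centeredArg s lam b θ x + centeredArg s lam b θ x ^ 2 / 2 + cst * varTerm b θ x

lemma varTerm_nonneg (b : ℝ) (θ x : Vec d) : 0 ≤ varTerm b θ x := by
  unfold varTerm; positivity

lemma exp_smoothed_le (s lam b : ℝ) (θ x : Vec d) :
    Real.exp (smoothed s lam b θ x) ≤ 1 + momentPoly s lam b θ x := by
  have := exp_chi_add_le (varTerm_nonneg b θ x) (centeredArg s lam b θ x)
  unfold smoothed momentPoly
  linarith

lemma measurable_smoothed (s lam b : ℝ) :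
    Measurable (fun p : Vec d × Vec d => smoothed s lam b p.1 p.2) := by
  have h1 : Measurable (fun p : Vec d × Vec d => centeredArg s lam b p.1 p.2) := by
    unfold centeredArg; fun_prop
  have h2 : Measurable (fun p : Vec d × Vec d => varTerm b p.1 p.2) := by
    unfold varTerm; fun_prop
  exact (measurable_chi.comp h1).add (measurable_const.min h2)

lemma continuous_momentPoly (s lam b : ℝ) :
    Continuous (fun p : Vec d × Vec d => momentPoly s lam b p.1 p.2) := by
  unfold momentPoly centeredArg varTerm
  fun_prop

lemma abs_smoothed_le (s lam b : ℝ) (θ x : Vec d) :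
    |smoothed s lam b θ x| ≤ logCap + 4 * Real.log 2 := by
  have h := chi_bounds (centeredArg s lam b θ x)
  have h2 := log_two_le_logCap
  have hl2 : 0 < Real.log 2 := Real.log_pos (by norm_num)
  have h3 : 0 ≤ min (4 * Real.log 2) (varTerm b θ x) :=
    le_min (by positivity) (varTerm_nonneg b θ x)
  have h4 := min_le_left (4 * Real.log 2) (varTerm b θ x)
  unfold smoothed
  rw [abs_le]
  constructor <;> linarith

lemma inner_perturbed (b : ℝ) (θ g x : Vec d) :
    inner ℝ (θ + b • g) x = inner ℝ θ x + b * inner ℝ x g := by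
  rw [inner_add_left, real_inner_smul_left, real_inner_comm x g]

lemma psi_le_integral_smoothed {s : ℝ} (hs : s ^ 2 = 1) (lam b : ℝ) (θ x : Vec d) :
    psi (s * ((inner ℝ θ x) ^ 2 - lam))
      ≤ ∫ g, smoothed s lam b (θ + b • g) x ∂(stdGaussian (Vec d)) := by
  set γ := stdGaussian (Vec d) with hγ
  set m := inner ℝ θ x with hm
  have hl2 : 0 < Real.log 2 := Real.log_pos (by norm_num)
  have hY : ∀ g, centeredArg s lam b (θ + b • g) x = s * (m ^ 2 - b ^ 2 * ‖x‖ ^ 2 - lam)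
      + s * (2 * m * b) * inner ℝ x g + s * b ^ 2 * (inner ℝ x g) ^ 2 + 0 * (inner ℝ x g) ^ 3
      + 0 * (inner ℝ x g) ^ 4 := by
    intro g
    rw [centeredArg, inner_perturbed, ← hm]; ring
  obtain ⟨-, hYi⟩ := integral_poly_inner x (s * (m ^ 2 - b ^ 2 * ‖x‖ ^ 2 - lam))
    (s * (2 * m * b)) (s * b ^ 2) 0 0
  -- The subtracted b²‖x‖² is exactly the bias that the perturbation adds to ⟨θ, x⟩².
  have hmean : ∫ g, centeredArg s lam b (θ + b • g) x ∂γ = s * (m ^ 2 - lam) := by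
    simp only [hY]
    rw [hYi]; ring
  have hV : ∀ g, (centeredArg s lam b (θ + b • g) x - s * (m ^ 2 - lam)) ^ 2
      = b ^ 4 * ‖x‖ ^ 4 + (-4 * m * b ^ 3 * ‖x‖ ^ 2) * inner ℝ x g
        + (4 * m ^ 2 * b ^ 2 - 2 * b ^ 4 * ‖x‖ ^ 2) * (inner ℝ x g) ^ 2
        + 4 * m * b ^ 3 * (inner ℝ x g) ^ 3 + b ^ 4 * (inner ℝ x g) ^ 4 := by
    intro g
    rw [centeredArg, inner_perturbed, ← hm]
    linear_combination (2 * m * b * inner ℝ x g + b ^ 2 * (inner ℝ x g) ^ 2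
      - b ^ 2 * ‖x‖ ^ 2) ^ 2 * hs
  obtain ⟨hVint, hVi⟩ := integral_poly_inner x (b ^ 4 * ‖x‖ ^ 4) (-4 * m * b ^ 3 * ‖x‖ ^ 2)
    (4 * m ^ 2 * b ^ 2 - 2 * b ^ 4 * ‖x‖ ^ 2) (4 * m * b ^ 3) (b ^ 4)
  have hvar : ∫ g, (centeredArg s lam b (θ + b • g) x - s * (m ^ 2 - lam)) ^ 2 ∂γ
      = 4 * b ^ 2 * m ^ 2 * ‖x‖ ^ 2 + 2 * b ^ 4 * ‖x‖ ^ 4 := by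
    simp only [hV]
    rw [hVi]; ring
  have hmeas : Measurable (fun g => centeredArg s lam b (θ + b • g) x) := by
    unfold centeredArg; fun_prop
  have hL2 : MemLp (fun g => centeredArg s lam b (θ + b • g) x) 2 γ := by
    have h1 : MemLp (fun g => centeredArg s lam b (θ + b • g) x - s * (m ^ 2 - lam)) 2 γ := by
      rw [memLp_two_iff_integrable_sq (hmeas.sub_const _).aestronglyMeasurable]
      simp only [hV]
      exact hVint
    have := h1.add (memLp_const (s * (m ^ 2 - lam)))
    simpa [Pi.add_def] using this
  have hpsi := psi_integral_le hL2 hmean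
  rw [hvar] at hpsi
  set A := (4 * b ^ 2 * m ^ 2 * ‖x‖ ^ 2 + 2 * b ^ 4 * ‖x‖ ^ 4) / 8 with hA
  have hR : ∀ g, varTerm b (θ + b • g) x
      = b ^ 2 * ((m + b * inner ℝ x g) ^ 2 * ‖x‖ ^ 2) + b ^ 4 * ‖x‖ ^ 4 / 2 := by
    intro g
    rw [varTerm, inner_perturbed]
  have hRmeas : Measurable (fun g => min (4 * Real.log 2) (varTerm b (θ + b • g) x)) := by
    unfold varTerm; fun_prop
  have hRint : Integrable (fun g => min (4 * Real.log 2) (varTerm b (θ + b • g) x)) γ := by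
    refine Integrable.of_bound (C := 4 * Real.log 2) hRmeas.aestronglyMeasurable ?_
    refine Filter.Eventually.of_forall fun g => ?_
    rw [Real.norm_eq_abs, abs_of_nonneg (le_min (by positivity) (varTerm_nonneg _ _ _))]
    exact min_le_left _ _
  have hneg : MeasurePreserving (fun g : Vec d => -g) γ γ := ⟨by fun_prop, map_neg_stdGaussian⟩
  have hRneg : Integrable (fun g => min (4 * Real.log 2) (varTerm b (θ + b • -g) x)) γ :=
    hneg.integrable_comp_of_integrable hRint
  have hsymm : ∫ g, min (4 * Real.log 2) (varTerm b (θ + b • -g) x) ∂γ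
      = ∫ g, min (4 * Real.log 2) (varTerm b (θ + b • g) x) ∂γ := by
    conv_rhs => rw [hγ, ← map_neg_stdGaussian]
    rw [integral_map (by fun_prop) hRmeas.aestronglyMeasurable]
  -- The variance term at θ itself is 2A, but it is evaluated at θ + bg. One of ±g does not decrease
  -- ⟨·, x⟩², so the symmetrized integrand is at least min(4 log 2, 2A) = 2 min(log 4, A).
  have hmin : min (Real.log 4) A ≤ ∫ g, min (4 * Real.log 2) (varTerm b (θ + b • g) x) ∂γ := by
    have hl4 : Real.log 4 = 2 * Real.log 2 := by
      rw [show (4 : ℝ) = 2 ^ 2 by norm_num, Real.log_pow]; norm_num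
    have hpt : ∀ g, 2 * min (Real.log 4) A ≤ min (4 * Real.log 2) (varTerm b (θ + b • g) x)
        + min (4 * Real.log 2) (varTerm b (θ + b • -g) x) := by
      intro g
      have n1 : 0 ≤ min (4 * Real.log 2) (varTerm b (θ + b • g) x) :=
        le_min (by positivity) (varTerm_nonneg _ _ _)
      have n2 : 0 ≤ min (4 * Real.log 2) (varTerm b (θ + b • -g) x) :=
        le_min (by positivity) (varTerm_nonneg _ _ _)
      have key : ∀ g, m ^ 2 ≤ (m + b * inner ℝ x g) ^ 2 →
          2 * min (Real.log 4) A ≤ min (4 * Real.log 2) (varTerm b (θ + b • g) x) := by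
        intro g hg
        refine le_min ?_ ?_
        · have := min_le_left (Real.log 4) A
          linarith
        · have h1 := min_le_right (Real.log 4) A
          rw [hR]
          have h2 : b ^ 2 * (m ^ 2 * ‖x‖ ^ 2) ≤ b ^ 2 * ((m + b * inner ℝ x g) ^ 2 * ‖x‖ ^ 2) := by
            gcongr
          linarith
      rcases le_total 0 (m * (b * inner ℝ x g)) with hc | hc
      · have := key g (by nlinarith [sq_nonneg (b * inner ℝ x g)])
        linarith
      · have := key (-g) (by rw [inner_neg_right]; nlinarith [sq_nonneg (b * inner ℝ x g)])
        linarith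
    have := integral_mono (integrable_const (μ := γ) _) (hRint.add hRneg) hpt
    rw [integral_add' hRint hRneg, hsymm] at this
    simp at this
    linarith
  have hchi : Integrable (fun g => chi (centeredArg s lam b (θ + b • g) x)) γ := by
    refine Integrable.of_bound (C := logCap)
      (measurable_chi.comp hmeas).aestronglyMeasurable ?_
    refine Filter.Eventually.of_forall fun g => ?_
    have h := chi_bounds (centeredArg s lam b (θ + b • g) x)
    have h2 := log_two_le_logCap
    rw [Real.norm_eq_abs, abs_le]
    constructor <;> linarith
  unfold smoothed
  rw [integral_add hchi hRint]
  linarith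

/-- Source of the constants in `dev`: the square contributes 2 and 1 to the last two coefficients,
the variance term c and 3c/2. -/
lemma integral_momentPoly_gaussian {s : ℝ} (hs : s ^ 2 = 1) (lam b : ℝ) (θ x : Vec d) :
    ∫ g, momentPoly s lam b (θ + b • g) x ∂(stdGaussian (Vec d))
      = s * ((inner ℝ θ x) ^ 2 - lam) + ((inner ℝ θ x) ^ 2 - lam) ^ 2 / 2
        + (2 + cst) * b ^ 2 * ((inner ℝ θ x) ^ 2 * ‖x‖ ^ 2)
        + (2 + 3 * cst) / 2 * b ^ 4 * ‖x‖ ^ 4 := by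
  set m := inner ℝ θ x with hm
  have hY : ∀ g, momentPoly s lam b (θ + b • g) x
      = (s * (m ^ 2 - b ^ 2 * ‖x‖ ^ 2 - lam) + (m ^ 2 - b ^ 2 * ‖x‖ ^ 2 - lam) ^ 2 / 2
          + cst * (b ^ 2 * m ^ 2 * ‖x‖ ^ 2 + b ^ 4 * ‖x‖ ^ 4 / 2))
        + (s * (2 * m * b) + 2 * m * b * (m ^ 2 - b ^ 2 * ‖x‖ ^ 2 - lam)
          + cst * (2 * b ^ 3 * m * ‖x‖ ^ 2)) * inner ℝ x g
        + (s * b ^ 2 + b ^ 2 * (m ^ 2 - b ^ 2 * ‖x‖ ^ 2 - lam) + 2 * m ^ 2 * b ^ 2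
          + cst * b ^ 4 * ‖x‖ ^ 2) * (inner ℝ x g) ^ 2
        + 2 * m * b ^ 3 * (inner ℝ x g) ^ 3 + b ^ 4 / 2 * (inner ℝ x g) ^ 4 := by
    intro g
    rw [momentPoly, centeredArg, varTerm, inner_perturbed, ← hm]
    linear_combination ((m + b * inner ℝ x g) ^ 2 - b ^ 2 * ‖x‖ ^ 2 - lam) ^ 2 / 2 * hs
  simp only [hY]
  rw [(integral_poly_inner x _ _ _ _ _).2]
  ring

/-! ### Integrability of the moment polynomial -/

/-- A bound in product form, so that fourth moments of the law and of the Gaussian suffice for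
Fubini. -/
lemma abs_momentPoly_le (s lam b : ℝ) : ∃ C : ℝ, ∀ θ x : Vec d,
    |momentPoly s lam b θ x| ≤ C * ((1 + ‖θ‖ ^ 4) * (1 + ‖x‖ ^ 4)) := by
  have hc := cst_pos
  refine ⟨|s| * (1 + b ^ 2 + |lam|) + 3 * s ^ 2 * (1 + b ^ 4 + lam ^ 2)
    + cst * (b ^ 2 + b ^ 4), fun θ x => ?_⟩
  have hi : (inner ℝ θ x) ^ 2 ≤ ‖θ‖ ^ 2 * ‖x‖ ^ 2 := by
    rw [← mul_pow, sq_le_sq, abs_of_nonneg (by positivity : 0 ≤ ‖θ‖ * ‖x‖)]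
    exact abs_real_inner_le_norm θ x
  set i := (inner ℝ θ x) ^ 2 with hidef
  have hi0 : 0 ≤ i := sq_nonneg _
  set M := (1 + ‖θ‖ ^ 4) * (1 + ‖x‖ ^ 4) with hM
  set p := ‖θ‖ ^ 2 with hp
  set q := ‖x‖ ^ 2 with hq
  have hp0 : 0 ≤ p := sq_nonneg _
  have hq0 : 0 ≤ q := sq_nonneg _
  have hθ4 : ‖θ‖ ^ 4 = p ^ 2 := by rw [hp]; ring
  have hx4 : ‖x‖ ^ 4 = q ^ 2 := by rw [hq]; ring
  have hMe : M = 1 + p ^ 2 + q ^ 2 + p ^ 2 * q ^ 2 := by rw [hM, hθ4, hx4]; ring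
  have hpq : 0 ≤ p ^ 2 * q ^ 2 := by positivity
  have m1 : 1 ≤ M := by rw [hMe]; nlinarith [sq_nonneg p, sq_nonneg q]
  have m2 : q ≤ M := by rw [hMe]; nlinarith [sq_nonneg p, sq_nonneg (q - 1)]
  have m3 : q ^ 2 ≤ M := by rw [hMe]; nlinarith [sq_nonneg p]
  have m4 : i ^ 2 ≤ M := by
    have : i ^ 2 ≤ (p * q) ^ 2 := by gcongr
    rw [hMe]; nlinarith [sq_nonneg p, sq_nonneg q]
  have m5 : i ≤ M := by nlinarith [sq_nonneg (i - 1)]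
  have m6 : i * q ≤ M := by
    have : i * q ≤ p * q * q := by gcongr
    rw [hMe]
    nlinarith [sq_nonneg (p * q - q), sq_nonneg p]
  have hM0 : 0 ≤ M := by linarith
  have e1 : |centeredArg s lam b θ x| ≤ |s| * (1 + b ^ 2 + |lam|) * M := by
    rw [centeredArg, abs_mul, mul_assoc]
    apply mul_le_mul_of_nonneg_left _ (abs_nonneg s)
    have h1 : b ^ 2 * q ≤ b ^ 2 * M := by gcongr
    have h2 : |lam| * 1 ≤ |lam| * M := by gcongr
    have h3 := le_abs_self lam
    have h4 := neg_abs_le lam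
    have h5 : 0 ≤ b ^ 2 * q := by positivity
    have h6 : 0 ≤ |lam| * M := by positivity
    rw [abs_le]
    constructor <;> nlinarith
  have e2 : centeredArg s lam b θ x ^ 2 / 2 ≤ 3 * s ^ 2 * (1 + b ^ 4 + lam ^ 2) * M := by
    have h1 : (i - b ^ 2 * q - lam) ^ 2 ≤ 3 * (i ^ 2 + b ^ 4 * q ^ 2 + lam ^ 2) := by
      nlinarith [sq_nonneg (i + b ^ 2 * q), sq_nonneg (i + lam), sq_nonneg (b ^ 2 * q - lam)]
    have h2 : b ^ 4 * q ^ 2 ≤ b ^ 4 * M := by gcongr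
    have h3 : lam ^ 2 * 1 ≤ lam ^ 2 * M := by gcongr
    have h4 : (i - b ^ 2 * q - lam) ^ 2 ≤ 3 * (1 + b ^ 4 + lam ^ 2) * M := by nlinarith
    rw [centeredArg, mul_pow]
    have h5 := mul_le_mul_of_nonneg_left h4 (sq_nonneg s)
    have h6 : 0 ≤ s ^ 2 * (i - b ^ 2 * q - lam) ^ 2 := by positivity
    linarith
  have e3 : varTerm b θ x ≤ (b ^ 2 + b ^ 4) * M := by
    rw [varTerm, hx4]
    have h1 : b ^ 2 * (i * q) ≤ b ^ 2 * M := by gcongr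
    have h2 : b ^ 4 * q ^ 2 ≤ b ^ 4 * M := by gcongr
    have h3 : 0 ≤ b ^ 4 * q ^ 2 := by positivity
    linarith
  have e3' := mul_le_mul_of_nonneg_left e3 hc.le
  have e4 := mul_nonneg hc.le (varTerm_nonneg b θ x)
  have e5 : 0 ≤ centeredArg s lam b θ x ^ 2 / 2 := by positivity
  rw [momentPoly]
  calc _ ≤ |centeredArg s lam b θ x| + |centeredArg s lam b θ x ^ 2 / 2|
        + |cst * varTerm b θ x| := abs_add_three _ _ _
    _ ≤ _ := by
        rw [abs_of_nonneg e5, abs_of_nonneg e4]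
        linarith

section
variable {P : Measure (Vec d)} [IsProbabilityMeasure P]

lemma integrable_momentPoly (hP : Integrable (fun x : Vec d => ‖x‖ ^ 4) P) (s lam b : ℝ)
    (θ : Vec d) : Integrable (fun x => momentPoly s lam b θ x) P := by
  obtain ⟨C, hC⟩ := abs_momentPoly_le (d := d) s lam b
  refine ((((integrable_const 1).fun_add hP).const_mul (1 + ‖θ‖ ^ 4)).const_mul C).mono' ?_
    (Filter.Eventually.of_forall fun x => hC θ x)
  exact ((continuous_momentPoly s lam b).comp
    (Continuous.prodMk_right θ)).measurable.aestronglyMeasurable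

lemma integrable_prod_momentPoly (hP : Integrable (fun x : Vec d => ‖x‖ ^ 4) P) (s lam b : ℝ)
    (θ : Vec d) : Integrable (fun p : Vec d × Vec d => momentPoly s lam b (θ + b • p.1) p.2)
      ((stdGaussian (Vec d)).prod P) := by
  obtain ⟨C, hC⟩ := abs_momentPoly_le (d := d) s lam b
  have hg : Integrable (fun g : Vec d => ‖θ + b • g‖ ^ 4) (stdGaussian (Vec d)) := by
    have h1 : MemLp (fun g : Vec d => θ + b • g) 4 (stdGaussian (Vec d)) :=
      (memLp_const θ).add ((IsGaussian.memLp_id (stdGaussian (Vec d)) 4 (by simp)).const_smul b)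
    exact_mod_cast h1.integrable_norm_pow (by norm_num)
  refine ((((integrable_const 1).fun_add hg).mul_prod
    ((integrable_const 1).fun_add hP)).const_mul C).mono' ?_
    (Filter.Eventually.of_forall fun p => hC _ _)
  refine ((continuous_momentPoly s lam b).comp (f := fun p : Vec d × Vec d =>
    (θ + b • p.1, p.2)) (by fun_prop)).measurable.aestronglyMeasurable

end

/-! ### The PAC-Bayesian inequality -/

section
variable {P : Measure (Vec d)} [IsProbabilityMeasure P] {Ω : Type*} [MeasurableSpace Ω]
  {μ : Measure Ω} [IsProbabilityMeasure μ] {X : Fin n → Ω → Vec d}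

/-- The Gaussian average Z of exp(∑ F - nD) has mean at most 1 by Fubini and independence, so Z < t
outside probability 1/t. As Z does not involve θ, Donsker–Varadhan with the shift b⁻¹θ then serves
all θ at once. -/
lemma pac_bayes {P : Measure (Vec d)} (hX : ∀ k, Measurable (X k)) (hlaw : ∀ k, μ.map (X k) = P) (hindep : iIndepFun X μ)
    {F : Vec d → Vec d → ℝ} (hF : Measurable fun p : Vec d × Vec d => F p.1 p.2) {C : ℝ}
    (hFb : ∀ θ x, |F θ x| ≤ C) {D : Vec d → ℝ} (hD : Measurable D)
    (hFD : ∀ θ, ∫⁻ x, ENNReal.ofReal (Real.exp (F θ x)) ∂P ≤ ENNReal.ofReal (Real.exp (D θ)))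
    {b t : ℝ} (hb : b ≠ 0) (ht : 0 < t) :
    ∃ A : Set Ω, MeasurableSet A ∧ μ Aᶜ ≤ ENNReal.ofReal t⁻¹ ∧ ∀ ω ∈ A, ∀ θ : Vec d,
      Integrable (fun g => D (θ + b • g)) (stdGaussian (Vec d)) →
      ∑ k, ∫ g, F (θ + b • g) (X k ω) ∂(stdGaussian (Vec d))
        ≤ n * ∫ g, D (θ + b • g) ∂(stdGaussian (Vec d)) + ‖θ‖ ^ 2 / (2 * b ^ 2) + Real.log t := by
  set γ := stdGaussian (Vec d) with hγ
  have hFX : ∀ k, Measurable fun p : Ω × Vec d => F (b • p.2) (X k p.1) := fun k =>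
    hF.comp ((measurable_snd.const_smul b).prodMk ((hX k).comp measurable_fst))
  have hexpm : Measurable fun p : Ω × Vec d => ENNReal.ofReal
      (Real.exp (∑ k, F (b • p.2) (X k p.1) - n * D (b • p.2))) := by
    refine (Real.measurable_exp.comp ?_).ennreal_ofReal
    refine (Finset.measurable_sum _ fun k _ => hFX k).sub ?_
    exact (hD.comp (measurable_snd.const_smul b)).const_mul _
  let Z : Ω → ENNReal := fun ω => ∫⁻ g, ENNReal.ofReal
    (Real.exp (∑ k, F (b • g) (X k ω) - n * D (b • g))) ∂γ
  have hZ : Measurable Z := hexpm.lintegral_prod_right'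
  have hmean : ∫⁻ ω, Z ω ∂μ ≤ 1 := by
    rw [lintegral_lintegral_swap hexpm.aemeasurable]
    have hin : ∀ g, ∫⁻ ω, ENNReal.ofReal
        (Real.exp (∑ k, F (b • g) (X k ω) - n * D (b • g))) ∂μ ≤ 1 := by
      intro g
      have hFg : Measurable fun x => ENNReal.ofReal (Real.exp (F (b • g) x)) :=
        (Real.measurable_exp.comp (hF.comp (measurable_const.prodMk measurable_id))).ennreal_ofReal
      have e : ∀ ω, ENNReal.ofReal (Real.exp (∑ k, F (b • g) (X k ω) - n * D (b • g)))
          = ENNReal.ofReal (Real.exp (-(n * D (b • g))))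
            * ∏ k, ENNReal.ofReal (Real.exp (F (b • g) (X k ω))) := by
        intro ω
        rw [← ENNReal.ofReal_prod_of_nonneg fun _ _ => Real.exp_nonneg _, ← Real.exp_sum,
          ← ENNReal.ofReal_mul (Real.exp_nonneg _), ← Real.exp_add]
        ring_nf
      simp only [e]
      have hprod : Measurable fun ω => ∏ k, ENNReal.ofReal (Real.exp (F (b • g) (X k ω))) :=
        Finset.measurable_prod _ fun k _ => hFg.comp (hX k)
      rw [lintegral_const_mul _ hprod,
        lintegral_prod_eq_prod_lintegral_of_indepFun Finset.univ
          (fun k ω => ENNReal.ofReal (Real.exp (F (b • g) (X k ω))))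
          (hindep.comp (fun _ x => ENNReal.ofReal (Real.exp (F (b • g) x))) fun _ => hFg)
          fun k => hFg.comp (hX k)]
      have h1 : ∀ k, ∫⁻ ω, ENNReal.ofReal (Real.exp (F (b • g) (X k ω))) ∂μ
          ≤ ENNReal.ofReal (Real.exp (D (b • g))) := by
        intro k
        rw [← lintegral_map (f := fun x => ENNReal.ofReal (Real.exp (F (b • g) x))) hFg (hX k),
          hlaw k]
        exact hFD _
      calc _ ≤ ENNReal.ofReal (Real.exp (-(n * D (b • g))))
            * ∏ _k : Fin n, ENNReal.ofReal (Real.exp (D (b • g))) := by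
            gcongr with k
            exact h1 k
        _ = 1 := by
            rw [Finset.prod_const, ← ENNReal.ofReal_pow (Real.exp_nonneg _), ← Real.exp_nat_mul,
              ← ENNReal.ofReal_mul (Real.exp_nonneg _), ← Real.exp_add]
            simp
    calc _ ≤ ∫⁻ _, 1 ∂γ := lintegral_mono hin
      _ = 1 := by simp
  refine ⟨{ω | Z ω < ENNReal.ofReal t}, measurableSet_lt hZ measurable_const, ?_, ?_⟩
  · have h := mul_meas_ge_le_lintegral (μ := μ) hZ (ENNReal.ofReal t)
    have hc : {ω | Z ω < ENNReal.ofReal t}ᶜ = {ω | ENNReal.ofReal t ≤ Z ω} := by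
      ext ω; simp
    rw [hc, ENNReal.ofReal_inv_of_pos ht, ← one_div,
      ENNReal.le_div_iff_mul_le (Or.inl (by simpa using ht)) (Or.inl ENNReal.ofReal_ne_top),
      mul_comm]
    exact h.trans hmean
  · intro ω hω θ hi
    have hFm : ∀ k, Measurable fun g => F (b • g) (X k ω) := fun k =>
      (hFX k).comp (measurable_const.prodMk measurable_id)
    have hm : Measurable fun g => ∑ k, F (b • g) (X k ω) - n * D (b • g) :=
      (Finset.measurable_sum _ fun k _ => hFm k).sub
        ((hD.comp (measurable_id.const_smul b)).const_mul _)
    have hshift : ∀ g : Vec d, b • (g + b⁻¹ • θ) = θ + b • g := by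
      intro g
      rw [smul_add, smul_inv_smul₀ hb, add_comm]
    have hFi : ∀ k, Integrable (fun g => F (θ + b • g) (X k ω)) γ := by
      intro k
      refine Integrable.of_bound (C := C) ?_ (Filter.Eventually.of_forall fun g => hFb _ _)
      have := (hFm k).comp (measurable_id.add_const (b⁻¹ • θ))
      simp only [Function.comp_def, id, hshift] at this
      exact this.aestronglyMeasurable
    have hsi : Integrable (fun g => ∑ k, F (θ + b • g) (X k ω)) γ :=
      integrable_finsetSum _ fun k _ => hFi k
    have hdi : Integrable (fun g => n * D (θ + b • g)) γ := hi.const_mul _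
    have key := exp_integral_translate_le (b⁻¹ • θ) hm (by
      simp only [hshift]
      exact hsi.sub hdi)
    simp only [hshift] at key
    rw [← hγ, integral_sub hsi hdi, integral_finsetSum _ fun k _ => hFi k,
      integral_const_mul] at key
    have hlt := (ENNReal.ofReal_lt_ofReal_iff ht).1 (key.trans_lt hω)
    rw [← Real.lt_log_iff_exp_lt ht, norm_smul, mul_pow, norm_inv, Real.norm_eq_abs, inv_pow,
      sq_abs] at hlt
    have e : (b ^ 2)⁻¹ * ‖θ‖ ^ 2 / 2 = ‖θ‖ ^ 2 / (2 * b ^ 2) := by field_simp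
    linarith

/-! ### Moments of the law -/

lemma integrable_of_le_norm_pow_four (hP : Integrable (fun x : Vec d => ‖x‖ ^ 4) P) {f : Vec d → ℝ}
    (hf : Measurable f) {C : ℝ} (h : ∀ x, |f x| ≤ C * (1 + ‖x‖ ^ 4)) : Integrable f P :=
  (((integrable_const 1).fun_add hP).const_mul C).mono' hf.aestronglyMeasurable
    (Filter.Eventually.of_forall h)

lemma sq_le_one_add_pow_four (r : ℝ) : r ^ 2 ≤ 1 * (1 + r ^ 4) := by
  nlinarith [sq_nonneg (r ^ 2 - 1), sq_nonneg (r ^ 2)]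

lemma integrable_norm_sq (hP : Integrable (fun x : Vec d => ‖x‖ ^ 4) P) :
    Integrable (fun x : Vec d => ‖x‖ ^ 2) P := by
  refine integrable_of_le_norm_pow_four hP (by fun_prop) (C := 1) fun x => ?_
  rw [abs_of_nonneg (by positivity)]
  exact sq_le_one_add_pow_four _

lemma inner_sq_le (θ x : Vec d) : (inner ℝ θ x) ^ 2 ≤ ‖θ‖ ^ 2 * ‖x‖ ^ 2 := by
  rw [← mul_pow, sq_le_sq, abs_of_nonneg (by positivity : 0 ≤ ‖θ‖ * ‖x‖)]
  exact abs_real_inner_le_norm θ x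

lemma integrable_inner_sq (hP : Integrable (fun x : Vec d => ‖x‖ ^ 4) P) (θ : Vec d) :
    Integrable (fun x => (inner ℝ θ x) ^ 2) P := by
  refine ((integrable_norm_sq hP).const_mul (‖θ‖ ^ 2)).mono'
    (Measurable.aestronglyMeasurable (by fun_prop)) (Filter.Eventually.of_forall fun x => ?_)
  rw [Real.norm_eq_abs, abs_of_nonneg (by positivity)]
  exact inner_sq_le θ x

lemma integrable_inner_four {P : Measure (Vec d)}
    (hP : Integrable (fun x : Vec d => ‖x‖ ^ 4) P) (θ : Vec d) :
    Integrable (fun x => (inner ℝ θ x) ^ 4) P := by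
  refine (hP.const_mul (‖θ‖ ^ 4)).mono'
    (Measurable.aestronglyMeasurable (by fun_prop)) (Filter.Eventually.of_forall fun x => ?_)
  rw [Real.norm_eq_abs, abs_of_nonneg (by positivity)]
  have h := pow_le_pow_left₀ (by positivity) (inner_sq_le θ x) 2
  calc _ = ((inner ℝ θ x) ^ 2) ^ 2 := by ring
    _ ≤ _ := h
    _ = _ := by ring

lemma integrable_inner_sq_mul {P : Measure (Vec d)}
    (hP : Integrable (fun x : Vec d => ‖x‖ ^ 4) P) (θ : Vec d) :
    Integrable (fun x => (inner ℝ θ x) ^ 2 * ‖x‖ ^ 2) P := by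
  refine (hP.const_mul (‖θ‖ ^ 2)).mono'
    (Measurable.aestronglyMeasurable (by fun_prop)) (Filter.Eventually.of_forall fun x => ?_)
  rw [Real.norm_eq_abs, abs_of_nonneg (by positivity)]
  calc _ ≤ ‖θ‖ ^ 2 * ‖x‖ ^ 2 * ‖x‖ ^ 2 := by gcongr; exact inner_sq_le θ x
    _ = _ := by ring

lemma quad_gram (hP : Integrable (fun x : Vec d => ‖x‖ ^ 4) P) (θ : Vec d) :
    quad (gram P) θ = ∫ x, (inner ℝ θ x) ^ 2 ∂P := by
  have hij : ∀ i j : Fin d, Integrable (fun x : Vec d => θ i * (x i * x j) * θ j) P := by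
    intro i j
    have : Integrable (fun x : Vec d => x i * x j) P := by
      refine (integrable_norm_sq hP).mono' (Measurable.aestronglyMeasurable (by fun_prop))
        (Filter.Eventually.of_forall fun x => ?_)
      rw [norm_mul, pow_two]
      exact mul_le_mul (PiLp.norm_apply_le x i) (PiLp.norm_apply_le x j) (norm_nonneg _)
        (norm_nonneg _)
    exact (this.const_mul _).mul_const _
  have e : ∀ x : Vec d, (inner ℝ θ x) ^ 2 = ∑ i, ∑ j, θ i * (x i * x j) * θ j := by
    intro x
    rw [PiLp.inner_apply, pow_two, Finset.sum_mul_sum]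
    refine Finset.sum_congr rfl fun i _ => Finset.sum_congr rfl fun j _ => ?_
    simp
    ring
  simp only [e]
  rw [integral_finsetSum _ fun i _ => integrable_finsetSum _ fun j _ => hij i j]
  refine Finset.sum_congr rfl fun i _ => ?_
  rw [integral_finsetSum _ fun j _ => hij i j]
  refine Finset.sum_congr rfl fun j _ => ?_
  rw [integral_mul_const, integral_const_mul]
  rfl

lemma s4sq_sq {P : Measure (Vec d)} : s4sq P ^ 2 = ∫ x, ‖x‖ ^ 4 ∂P :=
  Real.sq_sqrt (integral_nonneg fun _ => by positivity)

/-- Young's inequality in place of Cauchy–Schwarz. The true values thus never exceed the top of the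
grid. -/
lemma quad_gram_le_s4sq (hP : Integrable (fun x : Vec d => ‖x‖ ^ 4) P) (hs : 0 < s4sq P) {θ : Vec d}
    (hθ : ‖θ‖ = 1) : quad (gram P) θ ≤ s4sq P := by
  rw [quad_gram hP]
  have h1 : ∫ x, (inner ℝ θ x) ^ 2 ∂P
      ≤ ∫ x, (2 * s4sq P)⁻¹ * (‖x‖ ^ 4 + s4sq P ^ 2) ∂P := by
    refine integral_mono (integrable_inner_sq hP θ)
      ((hP.fun_add (integrable_const _)).const_mul _) fun x => ?_
    refine (inner_sq_le θ x).trans ?_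
    rw [hθ, one_pow, one_mul, le_inv_mul_iff₀ (by positivity)]
    nlinarith [sq_nonneg (‖x‖ ^ 2 - s4sq P)]
  rw [integral_const_mul, integral_add hP (integrable_const _), ← s4sq_sq] at h1
  simp only [integral_const, probReal_univ, smul_eq_mul, one_mul] at h1
  calc _ ≤ _ := h1
    _ = s4sq P := by field_simp; ring

lemma inner_ae_zero (hP : Integrable (fun x : Vec d => ‖x‖ ^ 4) P) {θ : Vec d}
    (h : ∫ x, (inner ℝ θ x) ^ 2 ∂P = 0) : ∀ᵐ x ∂P, inner ℝ θ x = 0 := by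
  rw [integral_eq_zero_iff_of_nonneg (fun _ => sq_nonneg _) (integrable_inner_sq hP θ)] at h
  filter_upwards [h] with x hx
  simpa using hx

lemma integral_inner_four_le (hP : Integrable (fun x : Vec d => ‖x‖ ^ 4) P)
    (hκ : 0 < kurtosis P) (θ : Vec d) :
    ∫ x, (inner ℝ θ x) ^ 4 ∂P ≤ kurtosis P * (∫ x, (inner ℝ θ x) ^ 2 ∂P) ^ 2 := by
  rcases (integral_nonneg fun x => sq_nonneg (inner ℝ θ x) :
    0 ≤ ∫ x, (inner ℝ θ x) ^ 2 ∂P).eq_or_lt with h | h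
  · have h0 := inner_ae_zero hP h.symm
    rw [← h, integral_eq_zero_of_ae]
    · simp
    · filter_upwards [h0] with x hx
      simp [hx]
  · rw [← div_le_iff₀ (by positivity)]
    refine le_csSup ?_ ⟨θ, h, rfl⟩
    -- An unbounded set of ratios would have `sSup` equal to 0, against κ > 0.
    by_contra hb
    rw [kurtosis, Real.sSup_of_not_bddAbove hb] at hκ
    exact lt_irrefl _ hκ

lemma integral_inner_sq_mul_le (hP : Integrable (fun x : Vec d => ‖x‖ ^ 4) P)
    (hκ : 0 < kurtosis P) (hs : 0 < s4sq P) (θ : Vec d) :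
    ∫ x, (inner ℝ θ x) ^ 2 * ‖x‖ ^ 2 ∂P
      ≤ Real.sqrt (kurtosis P) * s4sq P * ∫ x, (inner ℝ θ x) ^ 2 ∂P := by
  rcases (integral_nonneg fun x => sq_nonneg (inner ℝ θ x) :
    0 ≤ ∫ x, (inner ℝ θ x) ^ 2 ∂P).eq_or_lt with h | h
  · have h0 := inner_ae_zero hP h.symm
    rw [← h, integral_eq_zero_of_ae]
    · simp
    · filter_upwards [h0] with x hx
      simp [hx]
  · have h4 := integral_inner_four_le hP hκ θ
    set N := ∫ x, (inner ℝ θ x) ^ 2 ∂P with hN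
    have hk : 0 < Real.sqrt (kurtosis P) := Real.sqrt_pos.2 hκ
    have hk2 : Real.sqrt (kurtosis P) ^ 2 = kurtosis P := Real.sq_sqrt hκ.le
    set r := Real.sqrt (kurtosis P) with hr
    -- The optimal weight in Young's inequality, which recovers the Cauchy–Schwarz bound.
    set τ := s4sq P / (r * N) with hτ
    have hτ0 : 0 < τ := by positivity
    have h1 : ∫ x, (inner ℝ θ x) ^ 2 * ‖x‖ ^ 2 ∂P
        ≤ ∫ x, (τ / 2 * (inner ℝ θ x) ^ 4 + (2 * τ)⁻¹ * ‖x‖ ^ 4) ∂P := by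
      refine integral_mono (integrable_inner_sq_mul hP θ)
        (((integrable_inner_four hP θ).const_mul _).fun_add (hP.const_mul _)) fun x => ?_
      have h2 : 0 ≤ (2 * τ)⁻¹ * (τ * (inner ℝ θ x) ^ 2 - ‖x‖ ^ 2) ^ 2 := by positivity
      have e : (2 * τ)⁻¹ * (τ * (inner ℝ θ x) ^ 2 - ‖x‖ ^ 2) ^ 2
          = τ / 2 * (inner ℝ θ x) ^ 4 + (2 * τ)⁻¹ * ‖x‖ ^ 4 - (inner ℝ θ x) ^ 2 * ‖x‖ ^ 2 := by
        field_simp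
        ring
      dsimp only
      linarith
    rw [integral_add ((integrable_inner_four hP θ).const_mul _) (hP.const_mul _),
      integral_const_mul, integral_const_mul, ← s4sq_sq] at h1
    calc _ ≤ _ := h1
      _ ≤ τ / 2 * (kurtosis P * N ^ 2) + (2 * τ)⁻¹ * s4sq P ^ 2 := by gcongr
      _ = _ := by
          rw [← hk2, hτ]
          field_simp
          ring

end

/-! ### Confidence regions cover the Gram matrix -/

section
variable {P : Measure (Vec d)} [IsProbabilityMeasure P] {Ω : Type*} [MeasurableSpace Ω]
  {μ : Measure Ω} [IsProbabilityMeasure μ] {X : Fin n → Ω → Vec d}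

lemma integral_integral_momentPoly_le (hP : Integrable (fun x : Vec d => ‖x‖ ^ 4) P)
    (hκ : 0 < kurtosis P) (hs : 0 < s4sq P) {s : ℝ} (hsgn : s ^ 2 = 1) (lam b : ℝ) (θ : Vec d) :
    ∫ g, ∫ x, momentPoly s lam b (θ + b • g) x ∂P ∂(stdGaussian (Vec d))
      ≤ s * (quad (gram P) θ - lam)
        + (kurtosis P * quad (gram P) θ ^ 2 - 2 * lam * quad (gram P) θ + lam ^ 2) / 2
        + (2 + cst) * b ^ 2 * (Real.sqrt (kurtosis P) * s4sq P * quad (gram P) θ)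
        + (2 + 3 * cst) / 2 * b ^ 4 * s4sq P ^ 2 := by
  have hc := cst_pos
  rw [integral_integral_swap (integrable_prod_momentPoly hP s lam b θ)]
  simp only [integral_momentPoly_gaussian hsgn]
  have i2 := integrable_inner_sq hP θ
  have i4 := integrable_inner_four hP θ
  have im := integrable_inner_sq_mul hP θ
  have e : ∀ x : Vec d, s * ((inner ℝ θ x) ^ 2 - lam) + ((inner ℝ θ x) ^ 2 - lam) ^ 2 / 2
        + (2 + cst) * b ^ 2 * ((inner ℝ θ x) ^ 2 * ‖x‖ ^ 2)
        + (2 + 3 * cst) / 2 * b ^ 4 * ‖x‖ ^ 4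
      = (lam ^ 2 / 2 - s * lam) + (s - lam) * (inner ℝ θ x) ^ 2 + 1 / 2 * (inner ℝ θ x) ^ 4
        + (2 + cst) * b ^ 2 * ((inner ℝ θ x) ^ 2 * ‖x‖ ^ 2)
        + (2 + 3 * cst) / 2 * b ^ 4 * ‖x‖ ^ 4 := by
    intro x; ring
  simp only [e]
  have j1 := (integrable_const (μ := P) (lam ^ 2 / 2 - s * lam)).fun_add (i2.const_mul (s - lam))
  have j2 := j1.fun_add (i4.const_mul (1 / 2))
  have j3 := j2.fun_add (im.const_mul ((2 + cst) * b ^ 2))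
  rw [integral_add j3 (hP.const_mul _), integral_add j2 (im.const_mul _),
    integral_add j1 (i4.const_mul _), integral_add (integrable_const _) (i2.const_mul _)]
  simp only [integral_const_mul, integral_const, probReal_univ, smul_eq_mul, one_mul]
  have h4 := integral_inner_four_le hP hκ θ
  have hm := mul_le_mul_of_nonneg_left (integral_inner_sq_mul_le hP hκ hs θ)
    (show 0 ≤ (2 + cst) * b ^ 2 by positivity)
  rw [← s4sq_sq, quad_gram hP]
  linarith

/-- This is `pac_bayes` for the smoothed criterion with b² = 1/β and D the mean of `momentPoly`,
using 1 + D ≤ exp D. As ψ is odd, s = 1 and s = -1 give the two sides of the deviation bound. -/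
lemma exists_deviation_event (hP : Integrable (fun x : Vec d => ‖x‖ ^ 4) P)
    (hκ : 0 < kurtosis P) (hs : 0 < s4sq P) (hn : 0 < n)
    (hX : ∀ k, Measurable (X k)) (hlaw : ∀ k, μ.map (X k) = P) (hindep : iIndepFun X μ)
    {s : ℝ} (hsgn : s ^ 2 = 1) (lam : ℝ) {beta t : ℝ} (hbeta : 0 < beta) (ht : 0 < t) :
    ∃ A : Set Ω, MeasurableSet A ∧ μ Aᶜ ≤ ENNReal.ofReal t⁻¹ ∧ ∀ ω ∈ A, ∀ θ : Vec d,
      (n : ℝ)⁻¹ * ∑ k, psi (s * ((inner ℝ θ (X k ω)) ^ 2 - lam))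
        ≤ s * (quad (gram P) θ - lam)
          + (kurtosis P * quad (gram P) θ ^ 2 - 2 * lam * quad (gram P) θ + lam ^ 2) / 2
          + (2 + cst) * Real.sqrt (kurtosis P) * s4sq P * quad (gram P) θ / beta
          + (2 + 3 * cst) * s4sq P ^ 2 / (2 * beta ^ 2)
          + beta * ‖θ‖ ^ 2 / (2 * n) + Real.log t / n := by
  have hnR : (0 : ℝ) < n := by exact_mod_cast hn
  obtain ⟨b, hb, hb2⟩ : ∃ b : ℝ, b ≠ 0 ∧ b ^ 2 = beta⁻¹ :=
    ⟨Real.sqrt beta⁻¹, (Real.sqrt_pos.2 (by positivity)).ne', Real.sq_sqrt (by positivity)⟩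
  have hb4 : b ^ 4 = (beta ^ 2)⁻¹ := by
    rw [show b ^ 4 = (b ^ 2) ^ 2 by ring, hb2, inv_pow]
  have hD : Measurable fun θ => ∫ x, momentPoly s lam b θ x ∂P :=
    ((continuous_momentPoly s lam b).stronglyMeasurable.integral_prod_right
      (f := fun θ x => momentPoly s lam b θ x)).measurable
  obtain ⟨A, hA, hμA, h⟩ := pac_bayes hX hlaw hindep (measurable_smoothed s lam b)
    (abs_smoothed_le s lam b) hD (fun θ => by
      have hi := integrable_momentPoly hP s lam b θ
      have hi1 : Integrable (fun x => 1 + momentPoly s lam b θ x) P := (integrable_const 1).add hi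
      calc ∫⁻ x, ENNReal.ofReal (Real.exp (smoothed s lam b θ x)) ∂P
          ≤ ∫⁻ x, ENNReal.ofReal (1 + momentPoly s lam b θ x) ∂P :=
            lintegral_mono fun x => ENNReal.ofReal_le_ofReal (exp_smoothed_le s lam b θ x)
        _ = ENNReal.ofReal (∫ x, (1 + momentPoly s lam b θ x) ∂P) := by
            rw [ofReal_integral_eq_lintegral_ofReal hi1]
            exact Filter.Eventually.of_forall fun x =>
              (Real.exp_nonneg _).trans (exp_smoothed_le s lam b θ x)
        _ ≤ _ := by
            apply ENNReal.ofReal_le_ofReal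
            rw [integral_add (integrable_const _) hi]
            simp only [integral_const, probReal_univ, smul_eq_mul, one_mul]
            linarith [Real.add_one_le_exp (∫ x, momentPoly s lam b θ x ∂P)]) hb ht
  refine ⟨A, hA, hμA, fun ω hω θ => ?_⟩
  have h1 := h ω hω θ (integrable_prod_momentPoly hP s lam b θ).integral_prod_left
  have h2 : ∑ k, psi (s * ((inner ℝ θ (X k ω)) ^ 2 - lam))
      ≤ ∑ k, ∫ g, smoothed s lam b (θ + b • g) (X k ω) ∂(stdGaussian (Vec d)) :=
    Finset.sum_le_sum fun k _ => psi_le_integral_smoothed hsgn lam b θ (X k ω)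
  have h3 := integral_integral_momentPoly_le hP hκ hs hsgn lam b θ
  have h4 := mul_le_mul_of_nonneg_left h3 hnR.le
  have h5 := mul_le_mul_of_nonneg_left ((h2.trans h1).trans
    (add_le_add_left (add_le_add_left h4 _) _)) (inv_nonneg.2 hnR.le)
  refine h5.trans (le_of_eq ?_)
  rw [hb4, hb2]
  field_simp

/-- With probability at least `1 - 2ε`, every value of the quadratic form of the Gram matrix belongs
to its confidence region. -/
lemma exists_coverage_event (hP : Integrable (fun x : Vec d => ‖x‖ ^ 4) P)
    (hκ : 3 / 2 ≤ kurtosis P) (hs : 0 < s4sq P) (hn : 0 < n)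
    (hX : ∀ k, Measurable (X k)) (hlaw : ∀ k, μ.map (X k) = P) (hindep : iIndepFun X μ)
    {a ε : ℝ} (hε : 0 < ε) (hK : 1 ≤ gridSize n (kurtosis P) a) :
    ∃ A : Set Ω, MeasurableSet A ∧ 1 - 2 * ε ≤ μ.real A ∧ ∀ ω ∈ A, ∀ θ : Vec d, ‖θ‖ = 1 →
      quad (gram P) θ ∈ confRegion (kurtosis P) (s4sq P) a ε (fun k => X k ω) θ := by
  have hκ0 : 0 < kurtosis P := by linarith
  set K := gridSize n (kurtosis P) a with hKdef
  have hKR : (0 : ℝ) < K := by exact_mod_cast (by omega : 0 < K)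
  -- At level K/ε each event fails with probability at most ε/K; two signs and K scales give 2ε.
  have ht : 0 < (K : ℝ) / ε := by positivity
  have hex := fun (s : ℝ) (hsgn : s ^ 2 = 1) (j : ℤ) => exists_deviation_event (μ := μ) hP hκ0 hs hn
    hX hlaw hindep hsgn (lamGrid n (kurtosis P) a ε j)
    (betaGrid_pos (s := s4sq P) hn hκ hs a j) ht
  choose A hAm hAμ hA using hex
  let J := Finset.Icc 1 K
  let E : Set Ω := ⋂ j ∈ J, (A 1 (by norm_num) j ∩ A (-1) (by norm_num) j)
  have hEm : MeasurableSet E :=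
    Finset.measurableSet_biInter _ fun j _ => (hAm _ _ _).inter (hAm _ _ _)
  have hEc : μ Eᶜ ≤ ENNReal.ofReal (2 * ε) := by
    have h1 : Eᶜ = ⋃ j ∈ J, ((A 1 (by norm_num) j)ᶜ ∪ (A (-1) (by norm_num) j)ᶜ) := by
      simp only [E, Set.compl_iInter, Set.compl_inter]
    have h2 : ∀ j ∈ J, μ ((A 1 (by norm_num) j)ᶜ ∪ (A (-1) (by norm_num) j)ᶜ)
        ≤ ENNReal.ofReal (2 * (ε / K)) := by
      intro j _
      calc _ ≤ ENNReal.ofReal ((K : ℝ) / ε)⁻¹ + ENNReal.ofReal ((K : ℝ) / ε)⁻¹ :=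
            (measure_union_le _ _).trans (add_le_add (hAμ _ _ _) (hAμ _ _ _))
        _ = _ := by
            rw [← ENNReal.ofReal_add (by positivity) (by positivity), inv_div]
            ring_nf
    rw [h1]
    calc _ ≤ ∑ j ∈ J, ENNReal.ofReal (2 * (ε / K)) :=
          (measure_biUnion_finset_le _ _).trans (Finset.sum_le_sum h2)
      _ = ENNReal.ofReal (2 * ε) := by
          have hcard : ((J.card : ℕ) : ℝ) = K := by
            rw [Int.card_Icc]
            have : ((K + 1 - 1).toNat : ℤ) = K := by omega
            exact_mod_cast this
          rw [Finset.sum_const, nsmul_eq_mul, ← ENNReal.ofReal_natCast,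
            ← ENNReal.ofReal_mul (by positivity), hcard]
          congr 1
          field_simp
  refine ⟨E, hEm, ?_, fun ω hω θ hθ => ⟨?_, fun j hj1 hjK α hα => ?_⟩⟩
  · have h1 := probReal_compl_eq_one_sub (μ := μ) hEm
    have h2 : μ.real Eᶜ ≤ 2 * ε := ENNReal.toReal_le_of_le_ofReal (by positivity) hEc
    linarith
  · rw [quad_gram hP]
    exact integral_nonneg fun _ => sq_nonneg _
  · have hωj := Set.mem_iInter₂.1 hω j (Finset.mem_Icc.2 ⟨hj1, hjK⟩)
    -- Uniformity in θ covers every multiple αθ, so α needs no union bound.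
    have hup := hA _ _ _ ω hωj.1 (α • θ)
    have hlo := hA _ _ _ ω hωj.2 (α • θ)
    have hq : quad (gram P) (α • θ) = α ^ 2 * quad (gram P) θ := by
      simp only [quad, PiLp.smul_apply, smul_eq_mul, Finset.mul_sum]
      refine Finset.sum_congr rfl fun i _ => Finset.sum_congr rfl fun j _ => by ring
    have hnorm : ‖α • θ‖ ^ 2 = α ^ 2 := by
      rw [norm_smul, hθ, mul_one, Real.norm_eq_abs, sq_abs]
    simp only [neg_mul, one_mul, psi_neg, Finset.sum_neg_distrib, mul_neg] at hup hlo
    rw [hq, hnorm] at hup hlo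
    rw [abs_le, crit, dev, ← hKdef]
    constructor <;> linarith

end

end RobustGram

end

/-! ### From the confidence regions to the eigenvalues -/

open RobustGram in
theorem corollary3p2 {d n : ℕ} [NeZero d]
    (P : Measure (Vec d)) [IsProbabilityMeasure P]
    (hP : Integrable (fun x : Vec d => ‖x‖ ^ 4) P)
    (a ε σ : ℝ) (ha : 0 < a) (hε : 0 < ε) (hσ : 0 < σ) (hσs : σ ≤ s4sq P)
    (hκ : 3 / 2 ≤ kurtosis P)
    (hζ : 8 * zeta n (kurtosis P) (s4sq P) a ε σ ≤ Real.sqrt n)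
    (δ : ℝ) (Θ : Finset (Vec d)) (hΘ : IsSphereNet δ Θ)
    {Ω : Type*} [MeasurableSpace Ω] (μ : Measure Ω) [IsProbabilityMeasure μ]
    (X : Fin n → Ω → Vec d) (hX : ∀ k, Measurable (X k)) (hlaw : ∀ k, μ.map (X k) = P)
    (hindep : iIndepFun X μ) :
    ∃ A : Set Ω, MeasurableSet A ∧ 1 - 2 * ε ≤ μ.real A ∧ ∀ ω ∈ A,
      (∃ Q, IsSolution (kurtosis P) (s4sq P) a ε Θ (fun k => X k ω) Q) ∧
      ∀ Q, IsSolution (kurtosis P) (s4sq P) a ε Θ (fun k => X k ω) Q →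
        ∀ i : Fin d,
          ((|eig (gram P) (gram_isHermitian P) i
              - eig (positivePart Q) (positivePart_isHermitian Q) i| : ℝ) : EReal)
            ≤ ((2 * max (eig (gram P) (gram_isHermitian P) 0) σ : ℝ) : EReal)
                * Bstar n (kurtosis P) (s4sq P) a ε σ (eig (gram P) (gram_isHermitian P) 0)
              + ((5 * δ * frob (gram P) + σ : ℝ) : EReal) ∧
          ((|eig (gram P) (gram_isHermitian P) i
              - eig (positivePart Q) (positivePart_isHermitian Q) i| : ℝ) : EReal)
            ≤ ((2 * max (eig (positivePart Q) (positivePart_isHermitian Q) 0) σ : ℝ) : EReal)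
                * Bstar n (kurtosis P) (s4sq P) a ε σ
                    (min (eig (positivePart Q) (positivePart_isHermitian Q) 0) (s4sq P))
              + ((5 * δ * frob (gram P) + σ : ℝ) : EReal) := by
  have hs : 0 < s4sq P := hσ.trans_le hσs
  have hn := natCast_pos_of_zeta_le hκ hs hσ hζ
  have hK : 1 ≤ gridSize n (kurtosis P) a := by
    obtain ⟨j, h1, h2, -, -⟩ := exists_grid_index hκ hs ha hσ hζ le_rfl hσs
    exact h1.trans h2
  -- For 2ε ≥ 1 the empty event suffices; otherwise ε < 1/2 and log(K/ε) is positive.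
  rcases le_or_gt 1 (2 * ε) with hε2 | hε2
  · exact ⟨∅, MeasurableSet.empty, by simpa using hε2, fun ω hω => absurd hω (Set.notMem_empty ω)⟩
  have hL : 0 < Real.log ((gridSize n (kurtosis P) a : ℝ) / ε) := by
    apply Real.log_pos
    rw [one_lt_div hε]
    have : (1 : ℝ) ≤ gridSize n (kurtosis P) a := by exact_mod_cast hK
    linarith
  obtain ⟨A, hA, hAμ, hcov⟩ := exists_coverage_event (a := a) hP hκ hs hn hX hlaw hindep hε hK
  refine ⟨A, hA, hAμ, fun ω hω => ?_⟩
  have hGsymm : (gram P).IsSymm := by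
    have := gram_isHermitian P
    rwa [Matrix.IsHermitian, Matrix.conjTranspose_eq_transpose_of_trivial] at this
  have hGadm : gram P ∈ admissible (kurtosis P) (s4sq P) a ε Θ fun k => X k ω :=
    ⟨hGsymm, fun θ hθ => hcov ω hω θ (hΘ.1 θ hθ)⟩
  refine ⟨exists_isSolution ⟨_, hGadm⟩, fun Q hQ i => ?_⟩
  have hQH : Q.IsHermitian := by
    rw [Matrix.IsHermitian, Matrix.conjTranspose_eq_transpose_of_trivial]
    exact hQ.1.1
  have hfrob : frob Q ≤ frob (gram P) := hQ.2 _ hGadm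
  have hδ : 0 ≤ δ := by
    obtain ⟨θ, hθ, -⟩ := exists_quad_eq_eig (gram P) (gram_isHermitian P) 0
    obtain ⟨θ', -, h⟩ := hΘ.2 θ hθ
    exact (norm_nonneg _).trans h
  have hfG := frob_nonneg (gram P)
  have hGeig : ∀ i, 0 ≤ eig (gram P) (gram_isHermitian P) i := by
    intro i
    obtain ⟨θ, -, h⟩ := exists_quad_eq_eig (gram P) (gram_isHermitian P) i
    rw [← h, quad_gram hP]
    exact integral_nonneg fun _ => sq_nonneg _
  have hG0s : eig (gram P) (gram_isHermitian P) 0 ≤ s4sq P := by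
    obtain ⟨θ, hθ, h⟩ := exists_quad_eq_eig (gram P) (gram_isHermitian P) 0
    rw [← h]
    exact quad_gram_le_s4sq hP hs hθ
  -- Both inequalities at once: T only has to dominate the top eigenvalue of G or that of Q.
  have main : ∀ T, (eig (gram P) (gram_isHermitian P) 0 ≤ T ∨ eig Q hQH 0 ≤ T) →
      |eig (gram P) (gram_isHermitian P) i - eig (positivePart Q) (positivePart_isHermitian Q) i|
        ≤ 2 * max T σ * relErr n (kurtosis P) (s4sq P) a ε (max (min T (s4sq P)) σ)
          + (5 * δ * frob (gram P) + σ) := by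
    intro T hT
    set B := max T σ * relErr n (kurtosis P) (s4sq P) a ε (max (min T (s4sq P)) σ) with hB
    have hdir : ∀ θ : Vec d, ‖θ‖ = 1 →
        |max (quad (gram P) θ) σ - max (quad Q θ) σ| ≤ 2 * B + 4 * δ * frob (gram P) := by
      intro θ hθ
      obtain ⟨θ', hθ', hdist⟩ := hΘ.2 θ hθ
      have hn' := hΘ.1 θ' hθ'
      have h1 := abs_sub_le_of_mem_confRegion (T := T) hκ hs ha hσ hL hσs hζ (hGadm.2 θ' hθ')
        (hQ.1.2 θ' hθ') (quad_gram_le_s4sq hP hs hn')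
        (hT.imp (fun h => (quad_le_eig_zero _ _ hn').trans h)
          fun h => (quad_le_eig_zero _ hQH hn').trans h)
      have h2 := abs_quad_sub_quad_le hGsymm hθ hn' hdist
      have h3 : |quad Q θ - quad Q θ'| ≤ 2 * δ * frob (gram P) :=
        (abs_quad_sub_quad_le hQ.1.1 hθ hn' hdist).trans (by gcongr)
      have h4 := abs_max_sub_max_le_abs (quad (gram P) θ) (quad (gram P) θ') σ
      have h5 := abs_max_sub_max_le_abs (quad Q θ) (quad Q θ') σ
      have h4' := abs_le.1 (h4.trans h2)
      have h5' := abs_le.1 (h5.trans h3)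
      have h1' := abs_le.1 h1
      rw [abs_le]
      constructor <;> linarith
    have hmono : Monotone fun u : ℝ => max u σ := fun _ _ h => max_le_max_right σ h
    -- The forms are only comparable after truncation at σ, so Courant–Fischer is applied through u
    -- ↦ max u σ, in both directions.
    have c1 := eig_compare (gram_isHermitian P) hQH hmono
      (η := 2 * B + 4 * δ * frob (gram P))
      (fun θ hθ => by have := (abs_le.1 (hdir θ hθ)).2; linarith) i
    have c2 := eig_compare hQH (gram_isHermitian P) hmono
      (η := 2 * B + 4 * δ * frob (gram P))
      (fun θ hθ => by have := (abs_le.1 (hdir θ hθ)).1; linarith) i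
    have hδf : 0 ≤ δ * frob (gram P) := mul_nonneg hδ hfG
    have hGi := hGeig i
    rw [eig_positivePart Q hQH]
    have e : 2 * max T σ * relErr n (kurtosis P) (s4sq P) a ε (max (min T (s4sq P)) σ) = 2 * B := by
      rw [hB]; ring
    rw [e, abs_le]
    -- For u ≥ 0, u ≤ max u σ ≤ u + σ removes the truncation, with max(·, 0) accounting for the
    -- positive part of Q. The net has cost 4δ‖G‖_F, within the stated 5δ‖G‖_F.
    have m1 := le_max_left (eig (gram P) (gram_isHermitian P) i) σ
    have m2 : max (eig (gram P) (gram_isHermitian P) i) σ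
        ≤ eig (gram P) (gram_isHermitian P) i + σ := max_le (by linarith) (by linarith)
    have m3 := le_max_left (eig Q hQH i) 0
    have m4 := le_max_right (eig Q hQH i) 0
    have m5 : max (eig Q hQH i) σ ≤ max (eig Q hQH i) 0 + σ := max_le (by linarith) (by linarith)
    have m6 : max (eig Q hQH i) 0 ≤ max (eig Q hQH i) σ := max_le_max_left _ hσ.le
    constructor <;> linarith
  constructor
  · have h := main _ (Or.inl le_rfl)
    rw [min_eq_left hG0s] at h
    rw [Bstar_eq_relErr hκ hs hσ hζ]
    exact_mod_cast h
  · have h := main (eig (positivePart Q) (positivePart_isHermitian Q) 0)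
      (Or.inr (by rw [eig_positivePart Q hQH]; exact le_max_left _ _))
    rw [Bstar_eq_relErr hκ hs hσ hζ]
    exact_mod_cast h
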